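/- For finite tournaments $T,T'$ with $|T|\le |T'|$, where $|T|$ denotes the number of vertices, let $p(T;T')$ be the probability that a uniformly random set of $|T|$ vertices of $T'$ induces a subtournament isomorphic to $T$. Let $T_5^7$ be the tournament on $\{0,1,2,3,4\}$ obtained from the transitive tournament (with arcs $i\to j$ for $i<j$) by reversing the arc between $0$ and $4$. For $n\ge 0$ let $R_{2n+1}$ (the carousel tournament) be the tournament on $\{0,\dots,2n\}$ with arcs $v\to (v+i)\bmod (2n+1)$ for $1\le i\le n$, and let $T_5^{12}=R_5$. Let $\mathcal A^0$ be the flag algebra of tournaments: the real vector space spanned by the isomorphism classes of finite tournaments modulo the relations $F=\sum_{|F'|=\ell}p(F;F')F'$ for $\ell\ge |F|$, with the product $F_1F_2=\sum_{|F'|=\ell}p(F_1,F_2;F')F'$ for $\ell\ge |F_1|+|F_2|$, where $p(F_1,F_2;F')$ is the probability that the two members of a uniformly random pair of disjoint vertex sets of $F'$ of sizes $|F_1|,|F_2|$ induce copies of $F_1$ and $F_2$ respectively, and with the empty tournament as unit. Let $\operatorname{Hom}^+(\mathcal A^0,\mathbb R)$ be the set of $\mathbb R$-algebra homomorphisms $\phi:\mathcal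 A^0\to\mathbb R$ with $\phi(T)\in[0,1]$ for every finite tournament $T$. A sequence $(T_n)_{n\in\mathbb N}$ of finite tournaments of strictly increasing sizes converges to $\phi\in\operatorname{Hom}^+(\mathcal A^0,\mathbb R)$ if $\lim_{n\to\infty}p(T;T_n)=\phi(T)$ for every finite tournament $T$. It is extremal for $T$ if $\lim_{n\to\infty}p(T;T_n)=\lim_{n\to\infty}\max\{p(T;T'):|T'|=n\}$. Theorem. We have $$\lim_{n\to\infty}\max\{p(T_5^7;T'):|T'|=n\}=\frac5{16},\qquad \lim_{n\to\infty}\max\{p(T_5^{12};T'):|T'|=n\}=\frac1{16}.$$ The sequence $(R_{2n+1})_{n\in\mathbb N}$ converges to some $\phi_{\mathrm R}\in\operatorname{Hom}^+(\mathcal A^0,\mathbb R)$. For each $T\in\{T_5^7,T_5^{12}\}$, a sequence of tournaments of strictly increasing sizes is extremal for $T$ if and only if it converges to $\phi_{\mathrm R}$. Moreover, every $\phi\in\operatorname{Hom}^+(\mathcal A^0,\mathbb R)$ satisfies $\phi(T_5^7)\le \frac5{16}$ and $\phi(T_5^{12})\le\frac1{16}$, and in each of the two inequalities equality holds if and only if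 $\phi=\phi_{\mathrm R}$. -/

import Mathlib

open Filter Topology

/-- A tournament on the vertex set `V`: a loopless digraph in which every pair of distinct vertices
is joined by exactly one arc. `T.Adj v w` means that `vw` is an arc (`v` beats `w`). -/
structure Tournament (V : Type*) extends Digraph V where
  irrefl : ∀ v, ¬ Adj v v
  adj_iff_not_adj : ∀ v w, v ≠ w → (Adj v w ↔ ¬ Adj w v)

namespace Tournament

/-- The subtournament induced by a set `S` of vertices. -/
def induce {W : Type*} (T : Tournament W) (S : Finset W) : Tournament S where
  Adj v w := T.Adj v w
  irrefl v := T.irrefl v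
  adj_iff_not_adj v w h := T.adj_iff_not_adj v w (fun e => h (Subtype.ext e))

/-- Two tournaments are isomorphic if some bijection of the vertex sets preserves arcs. -/
def Isom {V W : Type*} (T : Tournament V) (T' : Tournament W) : Prop :=
  Nonempty (T.Adj ≃r T'.Adj)

theorem Isom.refl {V : Type*} (T : Tournament V) : T.Isom T := ⟨RelIso.refl _⟩

theorem Isom.symm {V W : Type*} {T : Tournament V} {T' : Tournament W} (h : T.Isom T') :
    T'.Isom T := h.map RelIso.symm

theorem Isom.trans {U V W : Type*} {T : Tournament U} {T' : Tournament V} {T'' : Tournament W}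
    (h : T.Isom T') (h' : T'.Isom T'') : T.Isom T'' := by
  obtain ⟨f⟩ := h
  obtain ⟨g⟩ := h'
  exact ⟨f.trans g⟩

theorem isom_congr {U V W : Type*} {T : Tournament U} {T' : Tournament V} {T'' : Tournament W}
    (h : T.Isom T') : T.Isom T'' ↔ T'.Isom T'' :=
  ⟨fun k => h.symm.trans k, fun k => h.trans k⟩

open Classical in
/-- The set of the `k`-element vertex sets of `T'` that induce a copy of the `k`-vertex
tournament `T`. -/
noncomputable def copies {k n : ℕ} (T : Tournament (Fin k)) (T' : Tournament (Fin n)) :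
    Finset (Finset (Fin n)) :=
  {S ∈ (Finset.univ : Finset (Fin n)).powersetCard k | T.Isom (T'.induce S)}

/-- The unlabelled density `p(T; T')`: the probability that a uniformly random `k`-element vertex
set of `T'` induces a copy of the `k`-vertex tournament `T`. -/
noncomputable def density {k n : ℕ} (T : Tournament (Fin k)) (T' : Tournament (Fin n)) : ℝ :=
  ((T.copies T').card : ℝ) / (((Finset.univ : Finset (Fin n)).powersetCard k).card : ℝ)

/-- The pairs of disjoint vertex sets in `Fin n` of sizes `k` and `l`. -/
def disjointPairs (k l n : ℕ) : Finset (Finset (Fin n) × Finset (Fin n)) :=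
  {P ∈ (Finset.univ : Finset (Fin n)).powersetCard k ×ˢ
      (Finset.univ : Finset (Fin n)).powersetCard l | Disjoint P.1 P.2}

open Classical in
/-- The joint density `p(T₁, T₂; T')`: the probability that the first and the second member of a
uniformly random pair of disjoint vertex sets of the right sizes induce copies of `T₁` and `T₂`. -/
noncomputable def jointDensity {k l n : ℕ} (T₁ : Tournament (Fin k)) (T₂ : Tournament (Fin l))
    (T' : Tournament (Fin n)) : ℝ :=
  ((({P ∈ disjointPairs k l n |
      T₁.Isom (T'.induce P.1) ∧ T₂.Isom (T'.induce P.2)} :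
        Finset (Finset (Fin n) × Finset (Fin n))).card : ℕ) : ℝ) /
    ((disjointPairs k l n).card : ℝ)

theorem isom_induce_map {n : ℕ} {T T' : Tournament (Fin n)} (e : T.Adj ≃r T'.Adj)
    (S : Finset (Fin n)) : (T.induce S).Isom (T'.induce (S.map e.toEquiv.toEmbedding)) := by
  refine ⟨⟨(e.toEquiv.subtypeEquiv fun a => ?_), ?_⟩⟩
  · exact (Finset.mem_map' e.toEquiv.toEmbedding).symm
  · intro a b
    exact e.map_rel_iff

theorem density_congr {k n : ℕ} {T₁ T₂ : Tournament (Fin k)} {T₁' T₂' : Tournament (Fin n)}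
    (h : T₁.Isom T₂) (h' : T₁'.Isom T₂') : T₁.density T₁' = T₂.density T₂' := by
  obtain ⟨e⟩ := h'
  unfold density
  congr 2
  refine Finset.card_equiv (Equiv.finsetCongr e.toEquiv) fun S => ?_
  simp only [copies, Finset.mem_filter, Finset.mem_powersetCard, Finset.subset_univ, true_and,
    Equiv.finsetCongr_apply, Finset.card_map]
  have := isom_induce_map e S
  exact and_congr_right fun _ => ⟨fun k => (h.symm.trans k).trans this,
    fun k => (h.trans k).trans this.symm⟩

theorem jointDensity_congr {k l n : ℕ} {T₁ T₂ : Tournament (Fin k)} {U₁ U₂ : Tournament (Fin l)}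
    {T₁' T₂' : Tournament (Fin n)} (h : T₁.Isom T₂) (hU : U₁.Isom U₂) (h' : T₁'.Isom T₂') :
    T₁.jointDensity U₁ T₁' = T₂.jointDensity U₂ T₂' := by
  obtain ⟨e⟩ := h'
  unfold jointDensity
  congr 2
  refine Finset.card_equiv
    ((Equiv.finsetCongr e.toEquiv).prodCongr (Equiv.finsetCongr e.toEquiv)) fun P => ?_
  have h1 := isom_induce_map e P.1
  have h2 := isom_induce_map e P.2
  simp only [disjointPairs, Finset.mem_filter, Finset.mem_product, Finset.mem_powersetCard,
    Finset.subset_univ, true_and, Equiv.prodCongr_apply, Prod.map_fst, Prod.map_snd,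
    Equiv.finsetCongr_apply, Finset.card_map, Finset.disjoint_map]
  exact and_congr_right fun _ => and_congr
    ⟨fun k => (h.symm.trans k).trans h1, fun k => (h.trans k).trans h1.symm⟩
    ⟨fun k => (hU.symm.trans k).trans h2, fun k => (hU.trans k).trans h2.symm⟩

instance {V : Type*} [Finite V] : Finite (Tournament V) :=
  Finite.of_injective (fun T : Tournament V => (fun v w => T.Adj v w)) (by
    rintro ⟨⟨a⟩, _, _⟩ ⟨⟨b⟩, _, _⟩ h
    have h' : a = b := h
    subst h'
    rfl)

noncomputable instance {V : Type*} [Finite V] : Fintype (Tournament V) := Fintype.ofFinite _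

/-- The transitive tournament on a linear order. -/
def transitive (V : Type*) [LinearOrder V] : Tournament V where
  Adj v w := v < w
  irrefl v := lt_irrefl v
  adj_iff_not_adj _ _ h := ⟨fun k => k.asymm, fun k => lt_of_le_of_ne (not_lt.mp k) h⟩

instance {V : Type*} [LinearOrder V] : Nonempty (Tournament V) := ⟨transitive V⟩

/-- `max {p(T; T') : |T'| = n}`. -/
noncomputable def maxDensity {k : ℕ} (T : Tournament (Fin k)) (n : ℕ) : ℝ :=
  Finset.univ.sup' Finset.univ_nonempty fun T' : Tournament (Fin n) => T.density T'

/-- A sequence of tournaments is extremal for `T` if the density of `T` along it converges to the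
maximum asymptotic density of `T`, the limit of `max {p(T; T') : |T'| = n}`. -/
def IsExtremal {k : ℕ} (T : Tournament (Fin k)) {s : ℕ → ℕ}
    (S : ∀ i, Tournament (Fin (s i))) : Prop :=
  ∃ c : ℝ, Tendsto T.maxDensity atTop (𝓝 c) ∧ Tendsto (fun i => T.density (S i)) atTop (𝓝 c)

/-- Isomorphism of tournaments on `n` vertices. -/
instance isoSetoid (n : ℕ) : Setoid (Tournament (Fin n)) where
  r := Isom
  iseqv := ⟨Isom.refl, Isom.symm, Isom.trans⟩

end Tournament

/-- The set of tournaments on `n` vertices up to isomorphism. -/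
abbrev TournamentClass (n : ℕ) : Type := Quotient (Tournament.isoSetoid n)

noncomputable instance (n : ℕ) : Fintype (TournamentClass n) := Fintype.ofFinite _

namespace TournamentClass

/-- `p(F; F')` for isomorphism classes. -/
noncomputable def density {k n : ℕ} (F : TournamentClass k) (F' : TournamentClass n) : ℝ :=
  Quotient.liftOn₂ F F' Tournament.density fun _ _ _ _ h h' => Tournament.density_congr h h'

/-- `p(F₁, F₂; F')` for isomorphism classes. -/
noncomputable def jointDensity {k l n : ℕ} (F₁ : TournamentClass k) (F₂ : TournamentClass l)
    (F' : TournamentClass n) : ℝ :=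
  Quotient.liftOn F' (fun T' => Quotient.liftOn₂ F₁ F₂ (fun T₁ T₂ => T₁.jointDensity T₂ T')
      fun _ _ _ _ h h' => Tournament.jointDensity_congr h h' (Tournament.Isom.refl T'))
    fun _ _ h => by
      induction F₁, F₂ using Quotient.inductionOn₂
      exact Tournament.jointDensity_congr (Tournament.Isom.refl _) (Tournament.Isom.refl _) h

end TournamentClass

namespace FlagAlgebra

/-- The isomorphism class `F` (of size `n`) as an element of the polynomial ring on all isomorphism
classes of finite tournaments. -/
noncomputable def gen {n : ℕ} (F : TournamentClass n) :
    MvPolynomial (Σ n, TournamentClass n) ℝ :=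
  MvPolynomial.X ⟨n, F⟩

/-- The relations of the flag algebra of tournaments (over the empty type): the empty tournament is
the unit, `F = ∑ p(F; F') F'` over all `F'` of a size `l ≥ |F|`, and
`F₁ F₂ = ∑ p(F₁, F₂; F') F'` over all `F'` of a size `l ≥ |F₁| + |F₂|`. -/
inductive Rel : MvPolynomial (Σ n, TournamentClass n) ℝ → Prop
  | unit (F : TournamentClass 0) : Rel (gen F - 1)
  | chain {k l : ℕ} (h : k ≤ l) (F : TournamentClass k) :
      Rel (gen F - ∑ F' : TournamentClass l, MvPolynomial.C (F.density F') * gen F')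
  | mul {k₁ k₂ l : ℕ} (h : k₁ + k₂ ≤ l) (F₁ : TournamentClass k₁) (F₂ : TournamentClass k₂) :
      Rel (gen F₁ * gen F₂ -
        ∑ F' : TournamentClass l, MvPolynomial.C (F₁.jointDensity F₂ F') * gen F')

end FlagAlgebra

/-- The flag algebra `𝒜⁰` of tournaments over the empty type, presented as a commutative
`ℝ`-algebra: it is generated by the isomorphism classes of finite tournaments, subject to the
relations `FlagAlgebra.Rel`. As products of generators are linear combinations of generators, this
is the space of formal linear combinations of isomorphism classes modulo the span of all
`F - ∑ p(F; F') F'`, with the product `F₁ F₂ = ∑ p(F₁, F₂; F') F'`. -/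
abbrev FlagAlgebra : Type :=
  MvPolynomial (Σ n, TournamentClass n) ℝ ⧸ Ideal.span {f | FlagAlgebra.Rel f}

namespace FlagAlgebra

/-- The element of the flag algebra given by a tournament. -/
noncomputable def flag {k : ℕ} (T : Tournament (Fin k)) : FlagAlgebra :=
  Ideal.Quotient.mk _ (gen (Quotient.mk _ T))

end FlagAlgebra

/-- The positive homomorphisms `Hom⁺(𝒜⁰, ℝ)`: the algebra homomorphisms that take values in
`[0, 1]` on tournaments. -/
def PosHom : Type :=
  {φ : FlagAlgebra →ₐ[ℝ] ℝ //
    ∀ (k : ℕ) (T : Tournament (Fin k)), φ (FlagAlgebra.flag T) ∈ Set.Icc (0 : ℝ) 1}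

/-- The value `φ(T)`. -/
noncomputable def PosHom.eval (φ : PosHom) {k : ℕ} (T : Tournament (Fin k)) : ℝ :=
  φ.1 (FlagAlgebra.flag T)

namespace Tournament

/-- A sequence of tournaments converges to `φ` if the sizes are increasing and
`p(T; S i) → φ(T)` for every finite tournament `T`. -/
def ConvergesTo {s : ℕ → ℕ} (S : ∀ i, Tournament (Fin (s i))) (φ : PosHom) : Prop :=
  StrictMono s ∧ ∀ (k : ℕ) (T : Tournament (Fin k)),
    Tendsto (fun i => T.density (S i)) atTop (𝓝 (φ.eval T))

/-- The carousel tournament `R_{2n+1}`: the vertices are `0, …, 2n` and the arcs are the pairs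
`(v, (v + i) mod (2n + 1))` with `1 ≤ i ≤ n`. -/
def carousel (n : ℕ) : Tournament (Fin (2 * n + 1)) where
  Adj v w := ∃ i : ℕ, 1 ≤ i ∧ i ≤ n ∧ (w : ℕ) = (v + i) % (2 * n + 1)
  irrefl v := by
    rintro ⟨i, h1, h2, h⟩
    have hv := v.2
    rcases lt_or_ge ((v : ℕ) + i) (2 * n + 1) with hlt | hge
    · rw [Nat.mod_eq_of_lt hlt] at h
      omega
    · rw [Nat.mod_eq_sub_mod hge, Nat.mod_eq_of_lt (by omega)] at h
      omega
  adj_iff_not_adj v w hne := by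
    have hv := v.2
    have hw := w.2
    have hne' : (v : ℕ) ≠ w := fun e => hne (Fin.ext e)
    have key : ∀ a b : ℕ, a < 2 * n + 1 → b < 2 * n + 1 →
        ((∃ i : ℕ, 1 ≤ i ∧ i ≤ n ∧ b = (a + i) % (2 * n + 1)) ↔
          (a < b ∧ b ≤ a + n) ∨ (b + n < a)) := by
      intro a b ha hb
      constructor
      · rintro ⟨i, h1, h2, h⟩
        rcases lt_or_ge (a + i) (2 * n + 1) with hlt | hge
        · rw [Nat.mod_eq_of_lt hlt] at h
          omega
        · rw [Nat.mod_eq_sub_mod hge, Nat.mod_eq_of_lt (by omega)] at h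
          omega
      · rintro (h | h)
        · exact ⟨b - a, by omega, by omega, by rw [Nat.mod_eq_of_lt (by omega)]; omega⟩
        · exact ⟨b + (2 * n + 1) - a, by omega, by omega, by
            rw [Nat.mod_eq_sub_mod (by omega), Nat.mod_eq_of_lt (by omega)]; omega⟩
    rw [key _ _ hv hw, key _ _ hw hv]
    omega

/-- The tournament `T_5^7`: the transitive tournament on `0, 1, 2, 3, 4` with the arc between its
source `0` and its sink `4` reversed. -/
def T57 : Tournament (Fin 5) where
  Adj v w := (v < w ∧ ¬ (v = 0 ∧ w = 4)) ∨ (v = 4 ∧ w = 0)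
  irrefl := by decide
  adj_iff_not_adj := by decide

/-- The tournament `T_5^12 = R_5`: every vertex `v` of `ℤ/5` beats `v + 1` and `v + 2`. -/
def T512 : Tournament (Fin 5) := carousel 2

end Tournament

/-!
The theorem is about random tournaments rather than about finite ones. An `ExchangeableLaw`
records the law of an exchangeable random tournament by its expectations on finite vertex sets.
Positive homomorphisms give such laws (`ExchangeableLaw.ofPosHom`), and so do the ultrafilter
limits of sequences of tournaments of growing sizes (`ExchangeableLaw.ofSeq`); both keep track of
all densities. Hence everything follows from three facts about exchangeable laws.

*The bound.* On five vertices, `N - M * [T ≅ T₀]` dominates a sum of products of two values of the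
same function, taken at two extensions of a common part: the product of the four signs at a root,
and, for a split of the vertices into a triple and a pair, the product over the pair of a linear
form in the signs towards the triple, which depends on whether the triple is transitive or cyclic.
This is a finite check (`localBound_ofBits57`, `localBound_ofBits512`). Under an exchangeable law
two extensions of a common part are conditionally independent, so that such products have
nonnegative expectation (`ExchangeableLaw.E_copy_mul_copy_nonneg`). Integration gives `M * μ(T₀) ≤
N`, that is, `5 / 16` and `54 / 864 = 1 / 16`.

*Equality.* The inequality leaves slack for each cyclic triangle with two vertices that both beat
it, or that are both beaten by it. If equality holds, then these configurations have probability
`0`, and so have cyclic triangles that are beaten by, or beat, a fourth vertex: the law is locally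
transitive. Moreover the root term vanishes, so that every vertex beats half of the others. These
two properties are `ExchangeableLaw.IsCarousel` (see `ExchangeableLaw.isCarousel_of_mul_dens_eq`).

*Uniqueness.* Local transitivity is invariant under reversing all arcs at a vertex, and so is a
carousel law (`ExchangeableLaw.IsCarousel.prob_flip`): balance makes the sign of an arc at `x`
uncorrelated with everything off `x`, and, given the tournament off `x`, local transitivity makes
the arcs at `x` toward the first and the last vertex of a suitable linear order determine all of
them, up to the reversal in question, whenever they are both as prescribed or both reversed. By
such reversals every locally transitive labelled tournament becomes transitive. So all of them
have the same probability, and there is only one carousel law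
(`ExchangeableLaw.IsCarousel.E_unique`). Conditioning a carousel law on a disjoint part gives a
carousel law again; by uniqueness the parts are independent, which makes the densities
multiplicative, and they form a positive homomorphism (`ExchangeableLaw.IsCarousel.toPosHom`).
Finally, finite carousels are locally transitive and regular, so that their limits are carousel
laws; and under a carousel law all the products above have expectation zero, because they change
sign under reversal at a suitable vertex, and there is no slack for locally transitive
tournaments, whence equality holds in the bound (`ExchangeableLaw.IsCarousel.mul_dens_eq`).
-/

/-! ### The local inequality on five vertices -/

namespace TournamentMatrix

variable {V : Type*}

/-- The sign of the pair `(x, y)` for a Boolean adjacency matrix: `1` if `x` beats `y`, `-1` if `y`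
beats `x`, and `0` on the diagonal of a tournament. -/
def sgn (m : V → V → Bool) (x y : V) : ℤ :=
  bif m x y then 1 else bif m y x then -1 else 0

/-- `a`, `b`, `c` span a cyclic triangle. -/
def cyc (m : V → V → Bool) (a b c : V) : Bool :=
  (m a b && m b c && m c a) || (m b a && m c b && m a c)

/-- `x` beats each of `a`, `b`, `c`. -/
def dom (m : V → V → Bool) (x a b c : V) : Bool := m x a && m x b && m x c

/-- Each of `a`, `b`, `c` beats `x`. -/
def codom (m : V → V → Bool) (x a b c : V) : Bool := m a x && m b x && m c x

/-- The product of the signs of `x` towards `a`, `b`, `c`. -/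
def signProd (m : V → V → Bool) (a b c x : V) : ℤ := sgn m x a * sgn m x b * sgn m x c

/-- The linear form in the extension `x` of the triple `a`, `b`, `c` whose square is used when the
triple is transitive. -/
def transForm (m : V → V → Bool) (a b c x : V) : ℤ :=
  if cyc m a b c then 0 else signProd m a b c x

/-- The linear form in the extension `x` of the triple `a`, `b`, `c` whose square is used when the
triple is cyclic. -/
def cycForm (p l : ℤ) (m : V → V → Bool) (a b c x : V) : ℤ :=
  if cyc m a b c then p * signProd m a b c x + l * (sgn m x a + sgn m x b + sgn m x c) else 0

/-- The triangle `a`, `b`, `c` is cyclic and `x` beats all of it. -/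
def winForm (m : V → V → Bool) (a b c x : V) : ℤ :=
  if cyc m a b c && dom m x a b c then 1 else 0

/-- The triangle `a`, `b`, `c` is cyclic and all of it beats `x`. -/
def loseForm (m : V → V → Bool) (a b c x : V) : ℤ :=
  if cyc m a b c && codom m x a b c then 1 else 0

/-- The three signed `4`-cycles on `w, x, y, z` have product `-1`, so that one or all three of them
are negative; `good` says that it is one. It is all three exactly if one of the four vertices beats
or is beaten by a cyclic triangle formed by the other three. Repeated vertices are always good. -/
def good (m : V → V → Bool) (w x y z : V) : Bool :=
  !(sgn m w x * sgn m x y * sgn m y z * sgn m z w == -1 &&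
    sgn m w x * sgn m x z * sgn m z y * sgn m y w == -1)

/-- The sum over the ten ways of splitting five vertices into a triple and a pair. -/
def splitSum (g : Fin 5 → Fin 5 → Fin 5 → Fin 5 → Fin 5 → ℤ) : ℤ :=
  g 0 1 2 3 4 + g 0 1 3 2 4 + g 0 1 4 2 3 + g 0 2 3 1 4 + g 0 2 4 1 3 +
  g 0 3 4 1 2 + g 1 2 3 0 4 + g 1 2 4 0 3 + g 1 3 4 0 2 + g 2 3 4 0 1

/-- The sum over the five choices of a root. -/
def rootSum (g : Fin 5 → Fin 5 → Fin 5 → Fin 5 → Fin 5 → ℤ) : ℤ :=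
  g 0 1 2 3 4 + g 1 0 2 3 4 + g 2 0 1 3 4 + g 3 0 1 2 4 + g 4 0 1 2 3

/-- The product of the four signs at the root `r`. -/
def rootProd (m : V → V → Bool) (r a b c d : V) : ℤ :=
  sgn m r a * sgn m r b * (sgn m r c * sgn m r d)

/-- Some relabelling of the tournament `m` is the tournament `t`. -/
def matches5 (m t : Fin 5 → Fin 5 → Bool) : Bool :=
  ([0, 1, 2, 3, 4] : List (Fin 5)).any fun a =>
    ([0, 1, 2, 3, 4] : List (Fin 5)).any fun b => m a b == t 0 1 && m b a == t 1 0 &&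
    ([0, 1, 2, 3, 4] : List (Fin 5)).any fun c => m a c == t 0 2 && m c a == t 2 0 &&
      m b c == t 1 2 && m c b == t 2 1 &&
      ([0, 1, 2, 3, 4] : List (Fin 5)).any fun d => m a d == t 0 3 && m d a == t 3 0 &&
        m b d == t 1 3 && m d b == t 3 1 && m c d == t 2 3 && m d c == t 3 2 &&
        ([0, 1, 2, 3, 4] : List (Fin 5)).any fun e => m a e == t 0 4 && m e a == t 4 0 &&
          m b e == t 1 4 && m e b == t 4 1 && m c e == t 2 4 && m e c == t 4 2 &&
          m d e == t 3 4 && m e d == t 4 3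

/-- The product of the values at `x` and at `y` of the linear form that belongs to the triple
`a`, `b`, `c`, with weight `s` if the triple is transitive. -/
def splitTerm (s p l : ℤ) (m : V → V → Bool) (a b c x y : V) : ℤ :=
  if cyc m a b c then
    (p * signProd m a b c x + l * (sgn m x a + sgn m x b + sgn m x c)) *
      (p * signProd m a b c y + l * (sgn m y a + sgn m y b + sgn m y c))
  else s * (signProd m a b c x * signProd m a b c y)

/-- The sum of all products that have nonnegative expectation; `r` and `s` are the weights of the
products over a root and over a transitive triple. -/
def squares (r s p l : ℤ) (m : Fin 5 → Fin 5 → Bool) : ℤ :=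
  r * rootSum (rootProd m) + splitSum (splitTerm s p l m)

/-- The indicator that the triangle `a`, `b`, `c` is cyclic and that it is either beaten by both `x`
and `y` or beats both of them. -/
def twinForm (m : V → V → Bool) (a b c x y : V) : ℤ :=
  if cyc m a b c && ((dom m x a b c && dom m y a b c) || (codom m x a b c && codom m y a b c))
  then 1 else 0

/-- All five quadruples of vertices are good. -/
def allGood (m : Fin 5 → Fin 5 → Bool) : Bool :=
  good m 0 1 2 3 && good m 0 1 2 4 && good m 0 1 3 4 && good m 0 2 3 4 && good m 1 2 3 4

/-- The local inequality with constant `N`: after subtracting `M` times the indicator of the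
tournament `t` and the squares, what is left bounds the number of twins over cyclic triangles, and
it vanishes if all quadruples are good. The indicator is only evaluated if all quadruples are good;
this loses nothing for a tournament `t` with that property, and keeps the check cheap. -/
def localBound (N M r s p l : ℤ) (t m : Fin 5 → Fin 5 → Bool) : Bool :=
  if allGood m then splitSum (twinForm m) == 0 &&
    N - M * (if matches5 m t then 1 else 0) - squares r s p l m == 0
  else decide (splitSum (twinForm m) ≤ N - squares r s p l m)

/-- The five-vertex tournament with the given upper triangular part of its adjacency matrix. -/
def ofBits (b₀ b₁ b₂ b₃ b₄ b₅ b₆ b₇ b₈ b₉ : Bool) (i j : Fin 5) : Bool :=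
  match i.val, j.val with
  | 0, 1 => b₀
  | 1, 0 => !b₀
  | 0, 2 => b₁
  | 2, 0 => !b₁
  | 0, 3 => b₂
  | 3, 0 => !b₂
  | 0, 4 => b₃
  | 4, 0 => !b₃
  | 1, 2 => b₄
  | 2, 1 => !b₄
  | 1, 3 => b₅
  | 3, 1 => !b₅
  | 1, 4 => b₆
  | 4, 1 => !b₆
  | 2, 3 => b₇
  | 3, 2 => !b₇
  | 2, 4 => b₈
  | 4, 2 => !b₈
  | 3, 4 => b₉
  | 4, 3 => !b₉
  | _, _ => false

/-- The adjacency matrix of `T57`. -/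
def matrix57 : Fin 5 → Fin 5 → Bool :=
  ofBits true true true false true true true true true true

/-- The adjacency matrix of `T512`. -/
def matrix512 : Fin 5 → Fin 5 → Bool :=
  ofBits true true false false true true false true true true

theorem localBound_ofBits57 : ∀ b₀ b₁ b₂ b₃ b₄ b₅ b₆ b₇ b₈ b₉ : Bool,
    localBound 5 16 3 1 1 0 matrix57 (ofBits b₀ b₁ b₂ b₃ b₄ b₅ b₆ b₇ b₈ b₉) = true := by
  decide +kernel

theorem localBound_ofBits512 : ∀ b₀ b₁ b₂ b₃ b₄ b₅ b₆ b₇ b₈ b₉ : Bool,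
    localBound 54 864 6 24 7 (-5) matrix512 (ofBits b₀ b₁ b₂ b₃ b₄ b₅ b₆ b₇ b₈ b₉) = true := by
  decide +kernel

/-- A quadruple that is not good contains a cyclic triangle that the fourth vertex beats or that
beats the fourth vertex. -/
theorem exists_triangle_of_not_good (m : V → V → Bool) (w x y z : V)
    (h₁ : m x w = !m w x) (h₂ : m y w = !m w y) (h₃ : m z w = !m w z) (h₄ : m y x = !m x y)
    (h₅ : m z x = !m x z) (h₆ : m z y = !m y z) (hg : good m w x y z = false) :
    (cyc m w x y && (dom m z w x y || codom m z w x y) ||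
      cyc m w x z && (dom m y w x z || codom m y w x z) ||
      cyc m w y z && (dom m x w y z || codom m x w y z) ||
      cyc m x y z && (dom m w x y z || codom m w x y z)) = true := by
  unfold good sgn at hg
  unfold cyc dom codom
  rw [h₁, h₂, h₃, h₄, h₅, h₆] at *
  generalize m w x = b₁, m w y = b₂, m w z = b₃, m x y = b₄, m x z = b₅, m y z = b₆ at *
  clear h₁ h₂ h₃ h₄ h₅ h₆
  revert b₁ b₂ b₃ b₄ b₅ b₆
  decide

theorem splitTerm_eq (s p l : ℤ) (m : V → V → Bool) (a b c x y : V) :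
    splitTerm s p l m a b c x y = s * (transForm m a b c x * transForm m a b c y) +
      cycForm p l m a b c x * cycForm p l m a b c y := by
  unfold splitTerm transForm cycForm
  split_ifs <;> ring

/-- `localBound` as an inequality, and as an equality for good quadruples. -/
theorem localBound_spec {N M r s p l : ℤ} {t m : Fin 5 → Fin 5 → Bool}
    (h : localBound N M r s p l t m = true) (ht : matches5 m t = true → allGood m = true) :
    splitSum (twinForm m) ≤
        N - M * (if matches5 m t = true then 1 else 0) - squares r s p l m ∧
      (allGood m = true →
        N - M * (if matches5 m t = true then 1 else 0) - squares r s p l m = 0) := by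
  unfold localBound at h
  by_cases hg : allGood m = true
  · rw [if_pos hg] at h
    simp only [Bool.and_eq_true, beq_iff_eq] at h
    exact ⟨by rw [h.1, h.2], fun _ => h.2⟩
  · rw [if_neg hg] at h
    have hm : ¬ matches5 m t = true := fun e => hg (ht e)
    refine ⟨?_, fun e => absurd e hg⟩
    rw [if_neg hm, mul_zero, sub_zero]
    exact of_decide_eq_true h

end TournamentMatrix

/-! ### Averages over random embeddings -/

namespace Tournament

variable {U V W : Type*}

/-- The labelled tournament induced on `V` by an embedding into the vertex set of `T`. -/
def comap (T : Tournament W) (f : V ↪ W) : Tournament V where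
  Adj v w := T.Adj (f v) (f w)
  irrefl v := T.irrefl (f v)
  adj_iff_not_adj _ _ h := T.adj_iff_not_adj _ _ fun e => h (f.injective e)

theorem ext_adj {T T' : Tournament V} (h : ∀ v w, T.Adj v w ↔ T'.Adj v w) : T = T' := by
  obtain ⟨⟨a⟩, _, _⟩ := T
  obtain ⟨⟨b⟩, _, _⟩ := T'
  have : a = b := by
    funext v w
    exact propext (h v w)
  subst this
  rfl

theorem comap_comap (T : Tournament W) (f : U ↪ V) (g : V ↪ W) :
    (T.comap g).comap f = T.comap (f.trans g) := rfl

theorem isom_iff_exists_equiv {T : Tournament V} {T' : Tournament W} :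
    T.Isom T' ↔ ∃ e : V ≃ W, T'.comap e.toEmbedding = T := by
  constructor
  · rintro ⟨e⟩
    exact ⟨e.toEquiv, ext_adj fun v w => e.map_rel_iff⟩
  · rintro ⟨e, rfl⟩
    exact ⟨⟨e, Iff.rfl⟩⟩

theorem isom_comap_range (T : Tournament W) (f : V ↪ W) (S : Finset W)
    (hS : ∀ w, w ∈ S ↔ ∃ v, f v = w) : (T.comap f).Isom (T.induce S) := by
  refine ⟨⟨Equiv.ofBijective (fun v => (⟨f v, (hS _).2 ⟨v, rfl⟩⟩ : S)) ⟨?_, ?_⟩, Iff.rfl⟩⟩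
  · intro v w h
    exact f.injective (congrArg Subtype.val h)
  · rintro ⟨w, hw⟩
    obtain ⟨v, hv⟩ := (hS w).1 hw
    exact ⟨v, Subtype.ext hv⟩

end Tournament

/-- Any two embeddings into a finite type differ by a permutation. -/
theorem exists_perm_trans_eq {V W : Type*} [Finite V] [Finite W] (f g : V ↪ W) :
    ∃ σ : Equiv.Perm W, f.trans σ.toEmbedding = g := by
  classical
  cases nonempty_fintype V
  cases nonempty_fintype W
  let e : Set.range f ≃ Set.range g :=
    (Equiv.ofInjective f f.injective).symm.trans (Equiv.ofInjective g g.injective)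
  refine ⟨e.extendSubtype, ?_⟩
  ext v
  have := e.extendSubtype_apply_of_mem (f v) ⟨v, rfl⟩
  simp only [Function.Embedding.trans_apply, Equiv.coe_toEmbedding]
  rw [this]
  simp [e]

/-- If the fibres of `π` on the embeddings `V ↪ W` are permuted transitively by the permutations of
`W`, then the uniform distribution is pushed forward to a uniform distribution. -/
theorem average_comp {V W Y : Type*} [Fintype V] [Fintype W] [Nonempty (V ↪ W)]
    [Fintype (V ↪ W)] (π : (V ↪ W) → Y) (I : Finset Y) (hI : ∀ y, y ∈ I ↔ ∃ h, π h = y)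
    (hπ : ∀ (σ : Equiv.Perm W) (h h' : V ↪ W), π h = π h' →
      π (h.trans σ.toEmbedding) = π (h'.trans σ.toEmbedding)) (F : Y → ℝ) :
    (∑ h, F (π h)) / (Fintype.card (V ↪ W) : ℝ) = (∑ y ∈ I, F y) / (I.card : ℝ) := by
  classical
  obtain ⟨h₀⟩ := ‹Nonempty (V ↪ W)›
  let c : ℕ := (Finset.univ.filter fun h : V ↪ W => π h = π h₀).card
  have hc : ∀ y ∈ I, (Finset.univ.filter fun h : V ↪ W => π h = y).card = c := by
    intro y hy
    obtain ⟨h₁, rfl⟩ := (hI y).1 hy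
    obtain ⟨σ, hσ⟩ := exists_perm_trans_eq h₁ h₀
    refine Finset.card_bij' (fun h _ => h.trans σ.toEmbedding)
      (fun h _ => h.trans σ.symm.toEmbedding) ?_ ?_ ?_ ?_
    · intro h hh
      simp only [Finset.mem_filter, Finset.mem_univ, true_and] at hh ⊢
      rw [← hσ]
      exact hπ σ _ _ hh
    · intro h hh
      simp only [Finset.mem_filter, Finset.mem_univ, true_and] at hh ⊢
      have : h₁ = h₀.trans σ.symm.toEmbedding := by
        rw [← hσ]; ext; simp
      rw [this]
      exact hπ σ.symm _ _ hh
    · intro h _; ext; simp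
    · intro h _; ext; simp
  have hcpos : (c : ℝ) ≠ 0 := by
    have : h₀ ∈ Finset.univ.filter fun h : V ↪ W => π h = π h₀ := by simp
    exact_mod_cast (Finset.card_pos.2 ⟨h₀, this⟩).ne'
  have hmaps : ∀ h ∈ (Finset.univ : Finset (V ↪ W)), π h ∈ I := fun h _ => (hI _).2 ⟨h, rfl⟩
  have hsum : ∀ G : Y → ℝ, ∑ h, G (π h) = c * ∑ y ∈ I, G y := by
    intro G
    rw [← Finset.sum_fiberwise_of_maps_to hmaps, Finset.mul_sum]
    refine Finset.sum_congr rfl fun y hy => ?_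
    rw [Finset.sum_congr rfl (g := fun _ => G y) fun h hh => by rw [(Finset.mem_filter.1 hh).2]]
    rw [Finset.sum_const, hc y hy, nsmul_eq_mul]
  have h1 := hsum fun _ => 1
  simp only [Finset.sum_const, Finset.card_univ, nsmul_eq_mul, mul_one] at h1
  rw [hsum, h1, mul_div_mul_left _ _ hcpos]

namespace Tournament

open Classical in
/-- The mean of `g` on the tournament that a uniformly random embedding of `V` induces. -/
noncomputable def avg {V W : Type*} [Fintype V] [Fintype W] (S : Tournament W)
    (g : Tournament V → ℝ) : ℝ :=
  (∑ h : V ↪ W, g (S.comap h)) / (Fintype.card (V ↪ W) : ℝ)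

section

variable {U V W : Type*} [Fintype U] [Fintype V] [Fintype W]

theorem avg_nonneg (S : Tournament W) {g : Tournament V → ℝ} (hg : ∀ T, 0 ≤ g T) :
    0 ≤ S.avg g :=
  div_nonneg (Finset.sum_nonneg fun _ _ => hg _) (Nat.cast_nonneg _)

theorem avg_add (S : Tournament W) (g g' : Tournament V → ℝ) :
    S.avg (g + g') = S.avg g + S.avg g' := by
  simp [avg, Finset.sum_add_distrib, add_div]

theorem avg_smul (S : Tournament W) (c : ℝ) (g : Tournament V → ℝ) :
    S.avg (c • g) = c * S.avg g := by
  simp [avg, ← Finset.mul_sum, mul_div_assoc]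

theorem avg_one (S : Tournament W) (h : Nonempty (V ↪ W)) :
    S.avg (1 : Tournament V → ℝ) = 1 := by
  classical
  have : (Fintype.card (V ↪ W) : ℝ) ≠ 0 := by exact_mod_cast Fintype.card_ne_zero
  simp only [avg, Pi.one_apply, Finset.sum_const, Finset.card_univ, nsmul_eq_mul, mul_one]
  convert div_self this

theorem avg_congr (S : Tournament W) {g g' : Tournament V → ℝ}
    (h : ∀ f, g (S.comap f) = g' (S.comap f)) : S.avg g = S.avg g' := by
  simp [avg, h]

/-- A uniformly random embedding restricts to a uniformly random embedding. -/
theorem avg_comap (S : Tournament W) (hne : Nonempty (V ↪ W)) (f : U ↪ V)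
    (g : Tournament U → ℝ) : S.avg (fun T : Tournament V => g (T.comap f)) = S.avg g := by
  classical
  have key := average_comp (V := V) (W := W) (fun h => f.trans h) Finset.univ (fun y => by
    simp only [Finset.mem_univ, true_iff]
    obtain ⟨h⟩ := hne
    obtain ⟨σ, hσ⟩ := exists_perm_trans_eq (f.trans h) y
    exact ⟨h.trans σ.toEmbedding, hσ⟩) (fun σ h h' e => by
      have e' : f.trans h = f.trans h' := e
      change f.trans (h.trans _) = f.trans (h'.trans _)
      rw [← Function.Embedding.trans_assoc, e', Function.Embedding.trans_assoc])
    (fun h => g (S.comap h))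
  rw [Finset.card_univ] at key
  unfold avg
  convert key
  rfl

/-- The mean over a random embedding is an isomorphism invariant. -/
theorem avg_isom {S : Tournament W} {W' : Type*} [Fintype W'] {S' : Tournament W'}
    (h : S.Isom S') (g : Tournament V → ℝ) : S.avg g = S'.avg g := by
  classical
  obtain ⟨e, rfl⟩ := isom_iff_exists_equiv.1 h
  unfold avg
  congr 1
  · exact Fintype.sum_equiv (Equiv.embeddingCongr (Equiv.refl V) e) _ _ fun _ => rfl
  · exact_mod_cast Fintype.card_congr (Equiv.embeddingCongr (Equiv.refl V) e)

/-- A random subtournament of a random subtournament is a random subtournament. -/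
theorem avg_avg (S : Tournament W) (hne : Nonempty (V ↪ W)) (hne' : Nonempty (U ↪ V))
    (g : Tournament U → ℝ) :
    S.avg (fun T : Tournament V => T.avg g) = S.avg g := by
  classical
  have hc : (Fintype.card (U ↪ V) : ℝ) ≠ 0 := by exact_mod_cast Fintype.card_ne_zero
  calc S.avg (fun T : Tournament V => T.avg g)
      = (∑ f : U ↪ V, S.avg (fun T : Tournament V => g (T.comap f))) /
          (Fintype.card (U ↪ V) : ℝ) := by
        simp only [avg, ← Finset.sum_div]
        rw [Finset.sum_comm, div_right_comm]
    _ = S.avg g := by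
        simp only [avg_comap S hne, Finset.sum_const, Finset.card_univ, nsmul_eq_mul]
        rw [mul_div_cancel_left₀ _ hc]

end

open Classical in
/-- The indicator of the tournaments isomorphic to `T`. -/
noncomputable def isoInd {V W : Type*} (T : Tournament V) (U : Tournament W) : ℝ :=
  if T.Isom U then 1 else 0

theorem nonempty_embedding {V : Type*} [Fintype V] {n : ℕ} (h : Fintype.card V ≤ n) :
    Nonempty (V ↪ Fin n) :=
  Function.Embedding.nonempty_of_card_le (by simpa using h)

/-- The density as a mean over embeddings. -/
theorem density_eq_avg {k n : ℕ} (hkn : k ≤ n) (T : Tournament (Fin k)) (S : Tournament (Fin n)) :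
    T.density S = S.avg (T.isoInd : Tournament (Fin k) → ℝ) := by
  classical
  have : Nonempty (Fin k ↪ Fin n) := nonempty_embedding (by simpa using hkn)
  have key := average_comp (V := Fin k) (W := Fin n) (fun h => Finset.univ.map h)
    ((Finset.univ : Finset (Fin n)).powersetCard k) (fun A => by
      simp only [Finset.mem_powersetCard, Finset.subset_univ, true_and]
      constructor
      · intro hA
        refine ⟨(A.orderEmbOfFin hA).toEmbedding, ?_⟩
        ext x
        simp only [Finset.mem_map, Finset.mem_univ, true_and]
        have := Finset.range_orderEmbOfFin A hA
        exact (Set.ext_iff.1 this x)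
      · rintro ⟨h, rfl⟩
        simp) (fun σ h h' e => by
      have e' : Finset.univ.map h = Finset.univ.map h' := e
      change Finset.univ.map (h.trans _) = Finset.univ.map (h'.trans _)
      rw [← Finset.map_map, ← Finset.map_map, e'])
      (fun A => if T.Isom (S.induce A) then (1 : ℝ) else 0)
  unfold density avg copies
  rw [Finset.card_filter, Nat.cast_sum]
  simp only [Nat.cast_ite, Nat.cast_one, Nat.cast_zero]
  refine Eq.trans ?_ (key.symm.trans ?_)
  · congr 1
  · congr 1
    · refine Finset.sum_congr rfl fun h _ => ?_
      unfold isoInd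
      have := isom_comap_range S h (Finset.univ.map h) (by simp)
      congr 1
      exact propext ⟨fun k => k.trans this.symm, fun k => k.trans this⟩

/-- The joint density as a mean over embeddings of the disjoint union. -/
theorem jointDensity_eq_avg {k l n : ℕ} (hkn : k + l ≤ n) (T₁ : Tournament (Fin k))
    (T₂ : Tournament (Fin l)) (S : Tournament (Fin n)) :
    T₁.jointDensity T₂ S = S.avg (fun U : Tournament (Fin k ⊕ Fin l) =>
      T₁.isoInd (U.comap Function.Embedding.inl) * T₂.isoInd (U.comap Function.Embedding.inr)) := by
  classical
  have : Nonempty (Fin k ⊕ Fin l ↪ Fin n) := nonempty_embedding (by simpa using hkn)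
  have key := average_comp (V := Fin k ⊕ Fin l) (W := Fin n)
    (fun h => (Finset.univ.map (Function.Embedding.inl.trans h),
      Finset.univ.map (Function.Embedding.inr.trans h)))
    (disjointPairs k l n) (fun P => by
      obtain ⟨A, B⟩ := P
      simp only [disjointPairs, Finset.mem_filter, Finset.mem_product, Finset.mem_powersetCard,
        Finset.subset_univ, true_and, Prod.mk.injEq]
      constructor
      · rintro ⟨⟨hA, hB⟩, hAB⟩
        have hr := Finset.range_orderEmbOfFin A hA
        have hr' := Finset.range_orderEmbOfFin B hB
        refine ⟨⟨Sum.elim (A.orderEmbOfFin hA) (B.orderEmbOfFin hB), ?_⟩, ?_, ?_⟩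
        · refine Function.Injective.sumElim (A.orderEmbOfFin hA).injective
            (B.orderEmbOfFin hB).injective fun a b e => ?_
          exact Finset.disjoint_left.1 hAB (A.orderEmbOfFin_mem hA a)
            (e ▸ B.orderEmbOfFin_mem hB b)
        · ext x
          simp only [Finset.mem_map, Finset.mem_univ, true_and]
          exact Set.ext_iff.1 hr x
        · ext x
          simp only [Finset.mem_map, Finset.mem_univ, true_and]
          exact Set.ext_iff.1 hr' x
      · rintro ⟨h, rfl, rfl⟩
        refine ⟨⟨by simp, by simp⟩, ?_⟩
        rw [Finset.disjoint_left]
        simp) (fun σ h h' e => by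
      simp only [Prod.mk.injEq] at e ⊢
      simp only [← Function.Embedding.trans_assoc]
      rw [← Finset.map_map _ σ.toEmbedding, e.1,
        ← Finset.map_map (Function.Embedding.inr.trans h) σ.toEmbedding, e.2]
      simp only [Finset.map_map, and_self])
      (fun P => if T₁.Isom (S.induce P.1) ∧ T₂.Isom (S.induce P.2) then (1 : ℝ) else 0)
  unfold jointDensity avg
  rw [Finset.card_filter, Nat.cast_sum]
  simp only [Nat.cast_ite, Nat.cast_one, Nat.cast_zero]
  refine Eq.trans ?_ (key.symm.trans ?_)
  · congr 1
  · congr 1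
    · refine Finset.sum_congr rfl fun h _ => ?_
      have h1 := isom_comap_range S (Function.Embedding.inl.trans h)
        (Finset.univ.map (Function.Embedding.inl.trans h)) (by simp)
      have h2 := isom_comap_range S (Function.Embedding.inr.trans h)
        (Finset.univ.map (Function.Embedding.inr.trans h)) (by simp)
      unfold isoInd
      rw [ite_zero_mul_ite_zero, mul_one, comap_comap, comap_comap]
      congr 1
      exact propext (and_congr ⟨fun k => k.trans h1.symm, fun k => k.trans h1⟩
        ⟨fun k => k.trans h2.symm, fun k => k.trans h2⟩)

end Tournament

/-! ### Exchangeable laws -/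

/-- The law of an exchangeable random tournament on an infinite vertex set, given by the
expectations `E V g` of functions `g` of the labelled tournament induced on finitely many vertices. The labels
form an arbitrary finite type `V`, and `comap` says that the choice of the vertices that carry them
does not matter. -/
structure ExchangeableLaw where
  /-- The expectation of a function of the tournament on the vertices labelled by `V`. -/
  E : ∀ (V : Type) [Fintype V], (Tournament V → ℝ) →ₗ[ℝ] ℝ
  nonneg : ∀ (V : Type) [Fintype V] (g : Tournament V → ℝ), (∀ T, 0 ≤ g T) → 0 ≤ E V g
  one : ∀ (V : Type) [Fintype V], E V 1 = 1
  comap : ∀ (V W : Type) [Fintype V] [Fintype W] (f : V ↪ W) (g : Tournament V → ℝ),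
    E W (fun T => g (T.comap f)) = E V g

namespace ExchangeableLaw

variable (μ : ExchangeableLaw) {V W A B J : Type} [Fintype V] [Fintype W] [Fintype A] [Fintype B]
  [Fintype J]

theorem mono {g g' : Tournament V → ℝ} (h : ∀ T, g T ≤ g' T) : μ.E V g ≤ μ.E V g' := by
  have := μ.nonneg V (g' - g) fun T => by simpa using h T
  rw [map_sub] at this
  linarith

theorem E_sum {ι : Type*} (s : Finset ι) (g : ι → Tournament V → ℝ) :
    μ.E V (fun T => ∑ i ∈ s, g i T) = ∑ i ∈ s, μ.E V (g i) := by
  rw [← map_sum]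
  congr 1
  funext T
  simp

theorem E_const_mul (c : ℝ) (g : Tournament V → ℝ) : μ.E V (fun T => c * g T) = c * μ.E V g :=
  (μ.E V).map_smul c g

theorem E_const (c : ℝ) : μ.E V (fun _ => c) = c := by
  have : (fun _ : Tournament V => c) = c • (1 : Tournament V → ℝ) := by
    funext T
    simp
  rw [this, map_smul, μ.one, smul_eq_mul, mul_one]

theorem E_add (g g' : Tournament V → ℝ) :
    μ.E V (fun T => g T + g' T) = μ.E V g + μ.E V g' := (μ.E V).map_add g g'

theorem E_sub (g g' : Tournament V → ℝ) :
    μ.E V (fun T => g T - g' T) = μ.E V g - μ.E V g' := (μ.E V).map_sub g g'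

/-- If `0 ≤ g ≤ g'` and `g'` has expectation `0`, so has `g`. -/
theorem E_eq_zero_of_le {g g' : Tournament V → ℝ} (h0 : ∀ T, 0 ≤ g T) (h : ∀ T, g T ≤ g' T)
    (h' : μ.E V g' = 0) : μ.E V g = 0 :=
  le_antisymm (h' ▸ μ.mono h) (μ.nonneg V g h0)

/-- The embedding of `A ⊕ B` into `A` together with `J` copies of `B` that uses the copy `j`. -/
def copy (A B : Type) {J : Type} (j : J) : A ⊕ B ↪ A ⊕ B × J where
  toFun := Sum.map id fun b => (b, j)
  inj' := Function.Injective.sumMap Function.injective_id fun _ _ h => (Prod.mk.inj h).1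

/-- The map of the copies of `B` that is induced by an injective map of the index types. -/
def copies (A B : Type) {I J : Type} (i : I ↪ J) : A ⊕ B × I ↪ A ⊕ B × J where
  toFun := Sum.map id (Prod.map id i)
  inj' := Function.Injective.sumMap Function.injective_id
    (Function.Injective.prodMap Function.injective_id i.injective)

/-- The extensions of a common part `A` by independent copies of `B` are positively correlated. This
is the limit for `m → ∞` of the nonnegativity of the second moment of the sum over `m` copies. -/
theorem E_copy_mul_copy_nonneg (g : Tournament (A ⊕ B) → ℝ) :
    0 ≤ μ.E (A ⊕ B × Fin 2) (fun T => g (T.comap (copy A B 0)) * g (T.comap (copy A B 1))) := by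
  set c := μ.E (A ⊕ B × Fin 2) (fun T => g (T.comap (copy A B 0)) * g (T.comap (copy A B 1)))
    with hc
  set d := μ.E (A ⊕ B) (fun T => g T * g T) with hd
  have key : ∀ m : ℕ, 0 ≤ (m : ℝ) * d + (m * m - m) * c := by
    intro m
    have h0 : 0 ≤ μ.E (A ⊕ B × Fin m) (fun T => ∑ i : Fin m, ∑ j : Fin m,
        g (T.comap (copy A B i)) * g (T.comap (copy A B j))) := by
      refine μ.nonneg _ _ fun T => ?_
      rw [← Finset.sum_mul_sum]
      exact mul_self_nonneg _
    have h1 : ∀ i j : Fin m, μ.E (A ⊕ B × Fin m)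
        (fun T => g (T.comap (copy A B i)) * g (T.comap (copy A B j))) =
          if i = j then d else c := by
      intro i j
      split_ifs with hij
      · subst hij
        exact μ.comap _ _ (copy A B i) fun T => g T * g T
      · have hinj : Function.Injective ![i, j] := by
          intro a b
          fin_cases a <;> fin_cases b <;> simp [hij, Ne.symm hij]
        have := μ.comap _ _ (copies A B ⟨![i, j], hinj⟩)
          fun T => g (T.comap (copy A B 0)) * g (T.comap (copy A B 1))
        have h0 : (copy A B 0).trans (copies A B ⟨![i, j], hinj⟩) = copy A B i := by
          ext (a | b) <;> rfl
        have h1 : (copy A B 1).trans (copies A B ⟨![i, j], hinj⟩) = copy A B j := by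
          ext (a | b) <;> rfl
        simp only [Tournament.comap_comap, h0, h1] at this
        rw [hc, ← this]
    simp only [E_sum, h1] at h0
    have h2 : ∑ i : Fin m, ∑ j : Fin m, (if i = j then d else c) =
        (m : ℝ) * d + (m * m - m) * c := by
      have : ∀ i j : Fin m, (if i = j then d else c) = c + if i = j then d - c else 0 := by
        intro i j
        split_ifs <;> ring
      simp only [this, Finset.sum_add_distrib, Finset.sum_const, Finset.card_univ,
        Fintype.card_fin, nsmul_eq_mul, Finset.sum_ite_eq, Finset.mem_univ, if_true]
      ring
    rwa [h2] at h0
  by_contra hneg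
  push Not at hneg
  obtain ⟨m, hm⟩ := exists_nat_gt (d / (-c) + 1)
  have h3 := key m
  have hm0 : (0 : ℝ) < m := by
    have : 0 ≤ d := μ.nonneg _ _ fun T => mul_self_nonneg _
    have : 0 ≤ d / (-c) := div_nonneg this (by linarith)
    linarith
  have h4 : 0 ≤ d + (m - 1) * c := by
    by_contra h
    push Not at h
    nlinarith
  have h5 : d / (-c) < m - 1 := by linarith
  rw [div_lt_iff₀ (by linarith)] at h5
  linarith

/-- The positive correlation of two extensions of a common part, on any larger vertex set. -/
theorem E_mul_nonneg (e : A ⊕ B × Fin 2 ↪ W) (g : Tournament (A ⊕ B) → ℝ) :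
    0 ≤ μ.E W (fun T =>
      g (T.comap ((copy A B 0).trans e)) * g (T.comap ((copy A B 1).trans e))) := by
  have := μ.E_copy_mul_copy_nonneg g
  rw [← μ.comap _ _ e] at this
  exact this

/-- Jensen's inequality for the conditional mean of `g` given the part `A`. -/
theorem sq_E_le (e : A ⊕ B × Fin 2 ↪ W) (g : Tournament (A ⊕ B) → ℝ) :
    μ.E (A ⊕ B) g ^ 2 ≤
      μ.E W (fun T =>
        g (T.comap ((copy A B 0).trans e)) * g (T.comap ((copy A B 1).trans e))) := by
  set t := μ.E (A ⊕ B) g with ht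
  have h := μ.E_mul_nonneg e fun T => g T - t
  have h0 := μ.comap _ _ ((copy A B 0).trans e) g
  have h1 := μ.comap _ _ ((copy A B 1).trans e) g
  have : ∀ x y : ℝ, (x - t) * (y - t) = x * y - t * x - t * y + t * t := fun x y => by ring
  simp only [this, E_sub, E_add, E_const_mul, E_const] at h
  rw [h0, h1, ← ht] at h
  nlinarith

/-- If the conditional mean of `g` given the part `A` vanishes in quadratic mean, then `g` is
uncorrelated with every function of the part `A`. -/
theorem E_mul_eq_zero (g : Tournament (A ⊕ B) → ℝ)
    (hg : μ.E (A ⊕ B × Fin 2)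
      (fun T => g (T.comap (copy A B 0)) * g (T.comap (copy A B 1))) = 0)
    (h : Tournament A → ℝ) :
    μ.E (A ⊕ B) (fun T => h (T.comap Function.Embedding.inl) * g T) = 0 := by
  set t := μ.E (A ⊕ B) (fun T => h (T.comap Function.Embedding.inl) * g T) with ht
  set d := μ.E A (fun T => h T * h T) with hd
  have key : ∀ s : ℝ, 0 ≤ 2 * s * t + s * s * d := by
    intro s
    have h' := μ.E_copy_mul_copy_nonneg
      fun T : Tournament (A ⊕ B) => g T + s * h (T.comap Function.Embedding.inl)
    have h0 := μ.comap _ _ (copy A B (0 : Fin 2))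
      fun T => h (T.comap Function.Embedding.inl) * g T
    have h1 := μ.comap _ _ (copy A B (1 : Fin 2))
      fun T => h (T.comap Function.Embedding.inl) * g T
    have h2 := μ.comap _ _ (Function.Embedding.inl : A ↪ A ⊕ B × Fin 2) fun T => h T * h T
    have e : ∀ (T : Tournament (A ⊕ B × Fin 2)) (j : Fin 2),
        (T.comap (copy A B j)).comap Function.Embedding.inl = T.comap Function.Embedding.inl :=
      fun _ _ => rfl
    have e' : ∀ x y z : ℝ, (x + s * z) * (y + s * z) =
        x * y + s * (z * x) + s * (z * y) + s * s * (z * z) := fun x y z => by ring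
    simp only [e] at h' h0 h1
    simp only [e', E_add, E_const_mul] at h'
    rw [h0, h1, h2, hg] at h'
    linarith
  have hd0 : 0 ≤ d := μ.nonneg _ _ fun T => mul_self_nonneg _
  -- The minimum over `s` is at `-t / d`, where `d` may vanish; `d + 1` serves as well.
  have h1 := key (-t / (d + 1))
  have h2 : 2 * (-t / (d + 1)) * t + -t / (d + 1) * (-t / (d + 1)) * d =
      -(t ^ 2 * (d + 2) / (d + 1) ^ 2) := by
    field_simp
    ring
  rw [h2] at h1
  have h3 : 0 ≤ t ^ 2 * (d + 2) / (d + 1) ^ 2 := by positivity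
  have h4 : t ^ 2 * (d + 2) / (d + 1) ^ 2 = 0 := by linarith
  have h5 : (d + 1) ^ 2 ≠ 0 := by positivity
  rw [div_eq_zero_iff, or_iff_left h5, mul_eq_zero, or_iff_left (by linarith)] at h4
  exact pow_eq_zero_iff (two_ne_zero) |>.1 h4

/-- The density of a tournament in the random tournament. -/
noncomputable def dens {k : ℕ} (T : Tournament (Fin k)) : ℝ :=
  μ.E (Fin k) T.isoInd

/-- The expectations on `V` are determined by those of the functions of a tournament on `Fin k`. -/
theorem E_eq_E_avg {k : ℕ} (h : Fintype.card V ≤ k) (g : Tournament V → ℝ) :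
    μ.E V g = μ.E (Fin k) (fun T => T.avg g) := by
  classical
  obtain ⟨f₀⟩ := Tournament.nonempty_embedding h
  have hc : (Fintype.card (V ↪ Fin k) : ℝ) ≠ 0 := by
    have : Nonempty (V ↪ Fin k) := ⟨f₀⟩
    exact_mod_cast Fintype.card_ne_zero
  have : (fun T : Tournament (Fin k) => T.avg g) = fun T =>
      (Fintype.card (V ↪ Fin k) : ℝ)⁻¹ * ∑ f : V ↪ Fin k, g (T.comap f) := by
    funext T
    rw [Tournament.avg, div_eq_inv_mul]
  rw [this, E_const_mul, E_sum, Finset.sum_congr rfl fun f _ => μ.comap V (Fin k) f g]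
  simp only [Finset.sum_const, Finset.card_univ, nsmul_eq_mul]
  rw [inv_mul_cancel_left₀ hc]

theorem dens_eq_E_density {k l : ℕ} (h : k ≤ l) (T : Tournament (Fin k)) :
    μ.dens T = μ.E (Fin l) (fun U => T.density U) := by
  rw [dens, μ.E_eq_E_avg (k := l) (by simpa using h)]
  congr 1
  funext U
  exact (Tournament.density_eq_avg h T U).symm

theorem dens_congr {k : ℕ} {T T' : Tournament (Fin k)} (h : T.Isom T') : μ.dens T = μ.dens T' := by
  unfold dens
  congr 1
  funext U
  unfold Tournament.isoInd
  rw [propext (Tournament.isom_congr h)]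

theorem dens_nonneg {k : ℕ} (T : Tournament (Fin k)) : 0 ≤ μ.dens T :=
  μ.nonneg _ _ fun U => by unfold Tournament.isoInd; split_ifs <;> norm_num

theorem dens_le_one {k : ℕ} (T : Tournament (Fin k)) : μ.dens T ≤ 1 := by
  rw [← μ.one (Fin k)]
  refine μ.mono fun U => ?_
  unfold Tournament.isoInd
  split_ifs <;> simp

end ExchangeableLaw

/-! ### Integrating the local inequality -/

open TournamentMatrix

namespace Tournament

variable {V W : Type*}

open Classical in
/-- The Boolean adjacency matrix of a tournament. -/
noncomputable def mat (T : Tournament V) (x y : V) : Bool := decide (T.Adj x y)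

theorem mat_comap (T : Tournament W) (f : V ↪ W) : (T.comap f).mat = fun i j => T.mat (f i) (f j) :=
  rfl

theorem mat_eq_true {T : Tournament V} {x y : V} : T.mat x y = true ↔ T.Adj x y := by
  simp [mat]

theorem mat_self (T : Tournament V) (x : V) : T.mat x x = false := by
  simp [mat, T.irrefl x]

theorem mat_symm (T : Tournament V) {x y : V} (h : x ≠ y) : T.mat y x = !T.mat x y := by
  have := T.adj_iff_not_adj x y h
  by_cases hx : T.Adj x y <;> simp_all [mat]

theorem ext_mat {T T' : Tournament V} (h : T.mat = T'.mat) : T = T' :=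
  ext_adj fun v w => by rw [← mat_eq_true, ← mat_eq_true, h]

theorem mat_eq_ofBits (T : Tournament (Fin 5)) : T.mat =
    ofBits (T.mat 0 1) (T.mat 0 2) (T.mat 0 3) (T.mat 0 4) (T.mat 1 2) (T.mat 1 3) (T.mat 1 4)
      (T.mat 2 3) (T.mat 2 4) (T.mat 3 4) := by
  have h : ∀ x y : Fin 5, x ≠ y → T.mat y x = !T.mat x y := fun x y => T.mat_symm
  funext i j
  fin_cases i <;> fin_cases j <;>
    first
    | exact T.mat_self _
    | rfl
    | exact h _ _ (by decide)

theorem mat_T57 : T57.mat = matrix57 := by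
  funext i j
  rw [Bool.eq_iff_iff, mat_eq_true]
  revert i j
  change ∀ i j : Fin 5, ((i < j ∧ ¬ (i = 0 ∧ j = 4)) ∨ (i = 4 ∧ j = 0)) ↔ matrix57 i j = true
  decide

theorem mat_T512 : T512.mat = matrix512 := by
  funext i j
  rw [Bool.eq_iff_iff, mat_eq_true]
  change (∃ k : ℕ, 1 ≤ k ∧ k ≤ 2 ∧ (j : ℕ) = (i + k) % 5) ↔ _
  have : (∃ k : ℕ, 1 ≤ k ∧ k ≤ 2 ∧ (j : ℕ) = (i + k) % 5) ↔
      (j : ℕ) = (i + 1) % 5 ∨ (j : ℕ) = (i + 2) % 5 := by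
    constructor
    · rintro ⟨k, h1, h2, h3⟩
      interval_cases k
      · exact Or.inl h3
      · exact Or.inr h3
    · rintro (h | h)
      · exact ⟨1, le_rfl, by norm_num, h⟩
      · exact ⟨2, by norm_num, le_rfl, h⟩
  rw [this]
  clear this
  revert i j
  decide

theorem matches5_iff_isom {T T₀ : Tournament (Fin 5)} :
    matches5 T.mat T₀.mat = true ↔ T₀.Isom T := by
  rw [isom_iff_exists_equiv]
  simp only [matches5, List.any_eq_true, Bool.and_eq_true, beq_iff_eq]
  constructor
  · rintro ⟨a, -, b, -, h1, c, -, h2, d, -, h3, e, -, h4⟩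
    have hm : ∀ i j : Fin 5, T.mat (![a, b, c, d, e] i) (![a, b, c, d, e] j) = T₀.mat i j := by
      intro i j
      fin_cases i <;> fin_cases j <;> simp [mat_self, h1, h2, h3, h4]
    have hinj : Function.Injective ![a, b, c, d, e] := by
      intro i j hij
      by_contra hne
      have h := T₀.mat_symm hne
      rw [← hm, ← hm, hij, mat_self] at h
      simp at h
    refine ⟨Equiv.ofBijective _ (Finite.injective_iff_bijective.1 hinj), ext_mat ?_⟩
    funext i j
    exact hm i j
  · rintro ⟨σ, rfl⟩
    have hmem : ∀ i : Fin 5, i ∈ ([0, 1, 2, 3, 4] : List (Fin 5)) := by decide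
    refine ⟨σ 0, hmem _, σ 1, hmem _, ⟨rfl, rfl⟩, σ 2, hmem _, ?_, σ 3, hmem _, ?_,
      σ 4, hmem _, ?_⟩ <;>
      simp [mat_comap]

theorem good_of_not_distinct (T : Tournament V) {w x y z : V}
    (h : w = x ∨ w = y ∨ w = z ∨ x = y ∨ x = z ∨ y = z) : good T.mat w x y z = true := by
  have hs : ∀ a : V, sgn T.mat a a = 0 := fun a => by simp [sgn, mat_self]
  have hss : ∀ a b : V, sgn T.mat a b * sgn T.mat b a ≠ 1 := fun a b => by
    by_cases e : a = b
    · subst e; simp [hs]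
    · simp only [sgn, T.mat_symm e]
      cases T.mat a b <;> decide
  have hsq : ∀ a b : V, sgn T.mat a b * sgn T.mat b a = 0 ∨ sgn T.mat a b * sgn T.mat b a = -1 :=
      fun a b => by
    by_cases e : a = b
    · subst e; simp [hs]
    · simp only [sgn, T.mat_symm e]
      cases T.mat a b <;> decide
  unfold good
  rw [Bool.not_eq_true', Bool.and_eq_false_iff]
  simp only [beq_eq_false_iff_ne]
  rcases h with rfl | rfl | rfl | rfl | rfl | rfl
  · simp [hs]
  · left
    rcases hsq w x with h1 | h1 <;> rcases hsq w z with h2 | h2 <;>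
      rw [h1, mul_assoc, h2] <;> norm_num
  · simp [hs]
  · simp [hs]
  · left
    rw [mul_assoc (sgn T.mat w x), mul_comm (sgn T.mat w x), mul_assoc]
    rcases hsq x y with h1 | h1 <;> rcases hsq w x with h2 | h2 <;>
      rw [h1, h2] <;> norm_num
  · simp [hs]

/-- All quadruples of vertices are good: no vertex beats, or is beaten by, a cyclic triangle. -/
def AllGood (T : Tournament V) : Prop := ∀ w x y z, good T.mat w x y z = true

theorem AllGood.comap {T : Tournament W} (h : T.AllGood) (f : V ↪ W) : (T.comap f).AllGood :=
  fun w x y z => h (f w) (f x) (f y) (f z)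

theorem AllGood.of_isom {T : Tournament V} {T' : Tournament W} (h : T.Isom T') (hT : T'.AllGood) :
    T.AllGood := by
  obtain ⟨e, rfl⟩ := isom_iff_exists_equiv.1 h
  exact hT.comap _

theorem AllGood.mat_allGood {T : Tournament (Fin 5)} (h : T.AllGood) : allGood T.mat = true := by
  simp [allGood, h _ _ _ _]

/-- The local inequality for the density of `T₀` with constant `N / M`, where `r`, `s`, `p`, `l` are
the coefficients of the sum of squares (see `TournamentMatrix.squares`). The field `bound` runs over
all tournaments on five vertices. -/
structure HasLocalBound (T₀ : Tournament (Fin 5)) (N M r s p l : ℤ) : Prop where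
  allGood : T₀.AllGood
  root_pos : 0 < r
  trans_nonneg : 0 ≤ s
  bound : ∀ b₀ b₁ b₂ b₃ b₄ b₅ b₆ b₇ b₈ b₉ : Bool,
    localBound N M r s p l T₀.mat (ofBits b₀ b₁ b₂ b₃ b₄ b₅ b₆ b₇ b₈ b₉) = true

theorem hasLocalBound_T57 : T57.HasLocalBound 5 16 3 1 1 0 where
  allGood := by
    rw [AllGood, mat_T57]
    decide +kernel
  root_pos := by norm_num
  trans_nonneg := by norm_num
  bound := by
    rw [mat_T57]
    exact localBound_ofBits57

theorem hasLocalBound_T512 : T512.HasLocalBound 54 864 6 24 7 (-5) where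
  allGood := by
    rw [AllGood, mat_T512]
    decide +kernel
  root_pos := by norm_num
  trans_nonneg := by norm_num
  bound := by
    rw [mat_T512]
    exact localBound_ofBits512

variable {T₀ : Tournament (Fin 5)} {N M r s p l : ℤ}

/-- The local inequality for an arbitrary tournament on five vertices. -/
theorem HasLocalBound.spec (h : T₀.HasLocalBound N M r s p l) (T : Tournament (Fin 5)) :
    ((splitSum (twinForm T.mat) : ℤ) : ℝ) ≤
        N - M * T₀.isoInd T - (squares r s p l T.mat : ℤ) ∧
      (TournamentMatrix.allGood T.mat = true →
        (N : ℝ) - M * T₀.isoInd T - (squares r s p l T.mat : ℤ) = 0) := by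
  classical
  have hb := h.bound (T.mat 0 1) (T.mat 0 2) (T.mat 0 3) (T.mat 0 4) (T.mat 1 2) (T.mat 1 3)
    (T.mat 1 4) (T.mat 2 3) (T.mat 2 4) (T.mat 3 4)
  rw [← T.mat_eq_ofBits] at hb
  have hs := localBound_spec hb fun e =>
    AllGood.mat_allGood (h.allGood.of_isom (matches5_iff_isom.1 e).symm)
  have hi : T₀.isoInd T = ((if matches5 T.mat T₀.mat = true then 1 else 0 : ℤ) : ℝ) := by
    unfold isoInd
    simp only [matches5_iff_isom]
    split_ifs <;> simp
  rw [hi]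
  refine ⟨by exact_mod_cast hs.1, fun hg => by exact_mod_cast hs.2 hg⟩

end Tournament

open TournamentMatrix Tournament

namespace ExchangeableLaw

variable (μ : ExchangeableLaw)

/-- The random tournament is almost surely locally transitive and all its vertices beat one half of
the others. -/
structure IsCarousel : Prop where
  /-- The mean square of the difference of the out-degree and the in-degree of a vertex is zero. -/
  balanced : μ.E (Fin 3) (fun T => ((sgn T.mat 0 1 * sgn T.mat 0 2 : ℤ) : ℝ)) = 0
  /-- A bad quadruple has probability zero. -/
  good_ae : μ.E (Fin 4) (fun T => if good T.mat 0 1 2 3 = true then 0 else 1) = 0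

/-- Relabelling five distinct vertices in the standard order. -/
theorem E_relabel (G : (Fin 5 → Fin 5 → Bool) → Fin 5 → Fin 5 → Fin 5 → Fin 5 → Fin 5 → ℤ)
    (hG : ∀ m (σ : Fin 5 → Fin 5) a b c x y,
      G (fun i j => m (σ i) (σ j)) a b c x y = G m (σ a) (σ b) (σ c) (σ x) (σ y))
    {a b c x y : Fin 5} (h : Function.Injective ![a, b, c, x, y]) :
    μ.E (Fin 5) (fun T => (G T.mat a b c x y : ℝ)) =
      μ.E (Fin 5) (fun T => (G T.mat 0 1 2 3 4 : ℝ)) := by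
  rw [← μ.comap _ _ ⟨_, h⟩ fun T => (G T.mat 0 1 2 3 4 : ℝ)]
  congr 1
  funext T
  rw [mat_comap]
  exact congrArg _ (hG T.mat ![a, b, c, x, y] 0 1 2 3 4).symm

/-- The ten splittings of five vertices contribute equally to the expectation. -/
theorem E_splitSum (G : (Fin 5 → Fin 5 → Bool) → Fin 5 → Fin 5 → Fin 5 → Fin 5 → Fin 5 → ℤ)
    (hG : ∀ m (σ : Fin 5 → Fin 5) a b c x y,
      G (fun i j => m (σ i) (σ j)) a b c x y = G m (σ a) (σ b) (σ c) (σ x) (σ y)) :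
    μ.E (Fin 5) (fun T => (splitSum (G T.mat) : ℝ)) =
      10 * μ.E (Fin 5) (fun T => (G T.mat 0 1 2 3 4 : ℝ)) := by
  simp only [splitSum, Int.cast_add, E_add]
  rw [μ.E_relabel G hG (a := 0) (b := 1) (c := 3) (x := 2) (y := 4) (by decide),
    μ.E_relabel G hG (a := 0) (b := 1) (c := 4) (x := 2) (y := 3) (by decide),
    μ.E_relabel G hG (a := 0) (b := 2) (c := 3) (x := 1) (y := 4) (by decide),
    μ.E_relabel G hG (a := 0) (b := 2) (c := 4) (x := 1) (y := 3) (by decide),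
    μ.E_relabel G hG (a := 0) (b := 3) (c := 4) (x := 1) (y := 2) (by decide),
    μ.E_relabel G hG (a := 1) (b := 2) (c := 3) (x := 0) (y := 4) (by decide),
    μ.E_relabel G hG (a := 1) (b := 2) (c := 4) (x := 0) (y := 3) (by decide),
    μ.E_relabel G hG (a := 1) (b := 3) (c := 4) (x := 0) (y := 2) (by decide),
    μ.E_relabel G hG (a := 2) (b := 3) (c := 4) (x := 0) (y := 1) (by decide)]
  ring

/-- The five roots contribute equally to the expectation. -/
theorem E_rootSum (G : (Fin 5 → Fin 5 → Bool) → Fin 5 → Fin 5 → Fin 5 → Fin 5 → Fin 5 → ℤ)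
    (hG : ∀ m (σ : Fin 5 → Fin 5) a b c x y,
      G (fun i j => m (σ i) (σ j)) a b c x y = G m (σ a) (σ b) (σ c) (σ x) (σ y)) :
    μ.E (Fin 5) (fun T => (rootSum (G T.mat) : ℝ)) =
      5 * μ.E (Fin 5) (fun T => (G T.mat 0 1 2 3 4 : ℝ)) := by
  simp only [rootSum, Int.cast_add, E_add]
  rw [μ.E_relabel G hG (a := 1) (b := 0) (c := 2) (x := 3) (y := 4) (by decide),
    μ.E_relabel G hG (a := 2) (b := 0) (c := 1) (x := 3) (y := 4) (by decide),
    μ.E_relabel G hG (a := 3) (b := 0) (c := 1) (x := 2) (y := 4) (by decide),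
    μ.E_relabel G hG (a := 4) (b := 0) (c := 1) (x := 2) (y := 3) (by decide)]
  ring

/-- The triple `0, 1, 2` with the two further vertices `3` and `4`. -/
def tripleEmb : Fin 3 ⊕ Unit × Fin 2 ↪ Fin 5 :=
  ⟨Sum.elim ![0, 1, 2] fun b => ![3, 4] b.2, by decide⟩

/-- The root `0` with the two pairs `1, 2` and `3, 4`. -/
def rootEmb : Unit ⊕ Fin 2 × Fin 2 ↪ Fin 5 :=
  ⟨Sum.elim (fun _ => 0) fun b => ![![1, 3], ![2, 4]] b.1 b.2, by decide⟩

/-- The root `0` with the two vertices `1` and `2`. -/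
def pairEmb : Unit ⊕ Unit × Fin 2 ↪ Fin 3 :=
  ⟨Sum.elim (fun _ => 0) fun b => ![1, 2] b.2, by decide⟩

theorem E_transForm_nonneg :
    0 ≤ μ.E (Fin 5) (fun T => ((transForm T.mat 0 1 2 3 * transForm T.mat 0 1 2 4 : ℤ) : ℝ)) := by
  have := μ.E_mul_nonneg tripleEmb fun T =>
    (transForm T.mat (.inl 0) (.inl 1) (.inl 2) (.inr ()) : ℝ)
  simp only [Int.cast_mul]
  exact this

theorem E_cycForm_nonneg (p l : ℤ) :
    0 ≤ μ.E (Fin 5)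
      (fun T => ((cycForm p l T.mat 0 1 2 3 * cycForm p l T.mat 0 1 2 4 : ℤ) : ℝ)) := by
  have := μ.E_mul_nonneg tripleEmb fun T =>
    (cycForm p l T.mat (.inl 0) (.inl 1) (.inl 2) (.inr ()) : ℝ)
  simp only [Int.cast_mul]
  exact this

theorem E_splitTerm_nonneg {s : ℤ} (hs : 0 ≤ s) (p l : ℤ) :
    0 ≤ μ.E (Fin 5) (fun T => (splitTerm s p l T.mat 0 1 2 3 4 : ℝ)) := by
  have h1 := μ.E_transForm_nonneg
  have h2 := μ.E_cycForm_nonneg p l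
  have : (0 : ℝ) ≤ s := by exact_mod_cast hs
  simp only [splitTerm_eq, Int.cast_add]
  rw [E_add]
  simp only [Int.cast_mul s, E_const_mul]
  positivity

/-- Jensen's inequality for the square of the difference of the degrees of the root. -/
theorem sq_E_balance_le :
    μ.E (Fin 3) (fun T => ((sgn T.mat 0 1 * sgn T.mat 0 2 : ℤ) : ℝ)) ^ 2 ≤
      μ.E (Fin 5) (fun T => (rootProd T.mat 0 1 2 3 4 : ℝ)) := by
  have h := μ.sq_E_le rootEmb fun T =>
    ((sgn T.mat (.inl ()) (.inr 0) * sgn T.mat (.inl ()) (.inr 1) : ℤ) : ℝ)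
  have h' := μ.comap _ (Fin 3) (⟨Sum.elim (fun _ => 0) ![1, 2], by decide⟩ : Unit ⊕ Fin 2 ↪ Fin 3)
    fun T => ((sgn T.mat (.inl ()) (.inr 0) * sgn T.mat (.inl ()) (.inr 1) : ℤ) : ℝ)
  rw [← h'] at h
  simp only [rootProd, Int.cast_mul] at h ⊢
  exact h

theorem E_balance_nonneg :
    0 ≤ μ.E (Fin 3) (fun T => ((sgn T.mat 0 1 * sgn T.mat 0 2 : ℤ) : ℝ)) := by
  have h := μ.E_mul_nonneg pairEmb fun T => (sgn T.mat (.inl ()) (.inr ()) : ℝ)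
  simp only [Int.cast_mul]
  exact h

theorem E_twinForm_nonneg : 0 ≤ μ.E (Fin 5) (fun T => (twinForm T.mat 0 1 2 3 4 : ℝ)) :=
  μ.nonneg _ _ fun T => by
    unfold twinForm
    split_ifs <;> simp

theorem E_rootProd_nonneg : 0 ≤ μ.E (Fin 5) (fun T => (rootProd T.mat 0 1 2 3 4 : ℝ)) :=
  (sq_nonneg _).trans μ.sq_E_balance_le

/-- If almost no cyclic triangle is beaten by two vertices, then almost none is beaten by one. -/
theorem E_winForm_eq_zero (h : μ.E (Fin 5) (fun T => (twinForm T.mat 0 1 2 3 4 : ℝ)) = 0) :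
    μ.E (Fin 3 ⊕ Unit)
      (fun T => (winForm T.mat (.inl 0) (.inl 1) (.inl 2) (.inr ()) : ℝ)) = 0 := by
  have h1 := μ.sq_E_le tripleEmb fun T =>
    (winForm T.mat (.inl 0) (.inl 1) (.inl 2) (.inr ()) : ℝ)
  have h2 : μ.E (Fin 5) (fun T => ((winForm T.mat 0 1 2 3 : ℝ)) * (winForm T.mat 0 1 2 4 : ℝ)) ≤
      μ.E (Fin 5) (fun T => (twinForm T.mat 0 1 2 3 4 : ℝ)) := by
    refine μ.mono fun T => ?_
    norm_cast
    unfold winForm twinForm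
    cases cyc T.mat 0 1 2 <;> cases dom T.mat 3 0 1 2 <;> cases dom T.mat 4 0 1 2 <;>
      cases codom T.mat 3 0 1 2 <;> cases codom T.mat 4 0 1 2 <;> decide
  have h3 := h1.trans h2
  rw [h] at h3
  exact pow_eq_zero_iff two_ne_zero |>.1 (le_antisymm h3 (sq_nonneg _))

theorem E_loseForm_eq_zero (h : μ.E (Fin 5) (fun T => (twinForm T.mat 0 1 2 3 4 : ℝ)) = 0) :
    μ.E (Fin 3 ⊕ Unit)
      (fun T => (loseForm T.mat (.inl 0) (.inl 1) (.inl 2) (.inr ()) : ℝ)) = 0 := by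
  have h1 := μ.sq_E_le tripleEmb fun T =>
    (loseForm T.mat (.inl 0) (.inl 1) (.inl 2) (.inr ()) : ℝ)
  have h2 : μ.E (Fin 5) (fun T => ((loseForm T.mat 0 1 2 3 : ℝ)) * (loseForm T.mat 0 1 2 4 : ℝ)) ≤
      μ.E (Fin 5) (fun T => (twinForm T.mat 0 1 2 3 4 : ℝ)) := by
    refine μ.mono fun T => ?_
    norm_cast
    unfold loseForm twinForm
    cases cyc T.mat 0 1 2 <;> cases dom T.mat 3 0 1 2 <;> cases dom T.mat 4 0 1 2 <;>
      cases codom T.mat 3 0 1 2 <;> cases codom T.mat 4 0 1 2 <;> decide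
  have h3 := h1.trans h2
  rw [h] at h3
  exact pow_eq_zero_iff two_ne_zero |>.1 (le_antisymm h3 (sq_nonneg _))

/-- Without twins over cyclic triangles, bad quadruples have probability zero. -/
theorem E_good_eq_zero (h : μ.E (Fin 5) (fun T => (twinForm T.mat 0 1 2 3 4 : ℝ)) = 0) :
    μ.E (Fin 4) (fun T => if good T.mat 0 1 2 3 = true then 0 else 1) = 0 := by
  have hw := μ.E_winForm_eq_zero h
  have hl := μ.E_loseForm_eq_zero h
  have hrel : ∀ a b c x : Fin 4, Function.Injective ![a, b, c, x] →
      μ.E (Fin 4) (fun T => ((winForm T.mat a b c x + loseForm T.mat a b c x : ℤ) : ℝ)) = 0 := by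
    intro a b c x hi
    have hi' : Function.Injective (Sum.elim ![a, b, c] fun _ : Unit => x) := by
      have : (Sum.elim ![a, b, c] fun _ : Unit => x) =
          ![a, b, c, x] ∘ Sum.elim ![0, 1, 2] fun _ => 3 := by
        funext i
        rcases i with i | i
        · fin_cases i <;> rfl
        · rfl
      rw [this]
      exact hi.comp (by decide)
    rw [← μ.comap _ (Fin 4) ⟨_, hi'⟩] at hw hl
    have := congrArg₂ (· + ·) hw hl
    rw [add_zero] at this
    simp only [Int.cast_add]
    rw [E_add]
    exact this
  have hsum : μ.E (Fin 4) (fun T =>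
      ((winForm T.mat 0 1 2 3 + loseForm T.mat 0 1 2 3 : ℤ) : ℝ) +
      ((winForm T.mat 0 1 3 2 + loseForm T.mat 0 1 3 2 : ℤ) : ℝ) +
      ((winForm T.mat 0 2 3 1 + loseForm T.mat 0 2 3 1 : ℤ) : ℝ) +
      ((winForm T.mat 1 2 3 0 + loseForm T.mat 1 2 3 0 : ℤ) : ℝ)) = 0 := by
    rw [E_add, E_add, E_add, hrel _ _ _ _ (by decide), hrel _ _ _ _ (by decide),
      hrel _ _ _ _ (by decide), hrel _ _ _ _ (by decide)]
    norm_num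
  refine μ.E_eq_zero_of_le (fun T => by split_ifs <;> norm_num) (fun T => ?_) hsum
  have hnn : ∀ a b c x, (0 : ℤ) ≤ winForm T.mat a b c x + loseForm T.mat a b c x := by
    intro a b c x
    unfold winForm loseForm
    split_ifs <;> norm_num
  have hone : ∀ a b c x, (cyc T.mat a b c && (dom T.mat x a b c || codom T.mat x a b c)) = true →
      (1 : ℤ) ≤ winForm T.mat a b c x + loseForm T.mat a b c x := by
    intro a b c x
    unfold winForm loseForm
    cases cyc T.mat a b c <;> cases dom T.mat x a b c <;> cases codom T.mat x a b c <;> decide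
  norm_cast
  have n1 := hnn 0 1 2 3
  have n2 := hnn 0 1 3 2
  have n3 := hnn 0 2 3 1
  have n4 := hnn 1 2 3 0
  split_ifs with hg
  · push_cast
    positivity
  · have := exists_triangle_of_not_good T.mat 0 1 2 3 (T.mat_symm (by decide))
      (T.mat_symm (by decide)) (T.mat_symm (by decide)) (T.mat_symm (by decide))
      (T.mat_symm (by decide)) (T.mat_symm (by decide)) (by simpa using hg)
    rw [Bool.or_eq_true, Bool.or_eq_true, Bool.or_eq_true] at this
    rcases this with ((h' | h') | h') | h'
    · have := hone _ _ _ _ h'; omega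
    · have := hone _ _ _ _ h'; omega
    · have := hone _ _ _ _ h'; omega
    · have := hone _ _ _ _ h'; omega

variable {μ} {T₀ : Tournament (Fin 5)} {N M r s p l : ℤ}

/-- The integrated local inequality. -/
theorem integrated_bound (h : T₀.HasLocalBound N M r s p l) :
    10 * μ.E (Fin 5) (fun T => (twinForm T.mat 0 1 2 3 4 : ℝ)) ≤
      N - M * μ.dens T₀ - (r * (5 * μ.E (Fin 5) (fun T => (rootProd T.mat 0 1 2 3 4 : ℝ))) +
        10 * μ.E (Fin 5) (fun T => (splitTerm s p l T.mat 0 1 2 3 4 : ℝ))) := by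
  have h1 := μ.mono fun T => (h.spec T).1
  rw [μ.E_splitSum twinForm (fun _ _ _ _ _ _ _ => rfl)] at h1
  simp only [squares, Int.cast_add, Int.cast_mul, E_sub, E_add, E_const_mul, E_const] at h1
  rw [μ.E_splitSum (splitTerm s p l) (fun _ _ _ _ _ _ _ => rfl),
    μ.E_rootSum rootProd (fun _ _ _ _ _ _ _ => rfl)] at h1
  exact h1

/-- The upper bound `N / M` for the density of `T₀`. -/
theorem mul_dens_le (h : T₀.HasLocalBound N M r s p l) : M * μ.dens T₀ ≤ N := by
  have h1 := integrated_bound (μ := μ) h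
  have h2 := μ.E_twinForm_nonneg
  have h3 := μ.E_rootProd_nonneg
  have h4 := μ.E_splitTerm_nonneg h.trans_nonneg p l
  have h5 : (0 : ℝ) < r := by exact_mod_cast h.root_pos
  have h6 := mul_nonneg h5.le (mul_nonneg (by norm_num : (0 : ℝ) ≤ 5) h3)
  linarith

/-- Only carousel laws attain the upper bound. -/
theorem isCarousel_of_mul_dens_eq (h : T₀.HasLocalBound N M r s p l)
    (he : M * μ.dens T₀ = N) : μ.IsCarousel := by
  have h1 := integrated_bound (μ := μ) h
  have h2 := μ.E_twinForm_nonneg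
  have h3 := μ.E_rootProd_nonneg
  have h4 := μ.E_splitTerm_nonneg h.trans_nonneg p l
  have h5 : (0 : ℝ) < r := by exact_mod_cast h.root_pos
  have h6 := mul_nonneg h5.le (mul_nonneg (by norm_num : (0 : ℝ) ≤ 5) h3)
  have h7 : μ.E (Fin 5) (fun T => (rootProd T.mat 0 1 2 3 4 : ℝ)) = 0 := by
    have : (r : ℝ) * (5 * μ.E (Fin 5) (fun T => (rootProd T.mat 0 1 2 3 4 : ℝ))) = 0 := by
      linarith
    simpa [h5.ne'] using this
  refine ⟨?_, μ.E_good_eq_zero (by linarith)⟩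
  have h8 := μ.sq_E_balance_le
  rw [h7] at h8
  exact pow_eq_zero_iff two_ne_zero |>.1 (le_antisymm h8 (sq_nonneg _))

end ExchangeableLaw

/-! ### Reversing the arcs at a vertex -/

namespace Tournament

variable {V : Type*}

theorem sgn_symm (T : Tournament V) (x y : V) : sgn T.mat y x = -sgn T.mat x y := by
  by_cases h : x = y
  · subst h
    simp [sgn, mat_self]
  · simp only [sgn, T.mat_symm h]
    cases T.mat x y <;> decide

theorem sgn_eq_one_or (T : Tournament V) {x y : V} (h : x ≠ y) :
    sgn T.mat x y = 1 ∨ sgn T.mat x y = -1 := by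
  simp only [sgn, T.mat_symm h]
  cases T.mat x y <;> decide

theorem sgn_self (T : Tournament V) (x : V) : sgn T.mat x x = 0 := by
  simp [sgn, mat_self]

theorem mat_eq_of_sgn_eq {T T' : Tournament V} {x y : V} (h : sgn T.mat x y = sgn T'.mat x y) :
    T.mat x y = T'.mat x y := by
  by_cases hxy : x = y
  · subst hxy
    rw [mat_self, mat_self]
  · simp only [sgn, T.mat_symm hxy, T'.mat_symm hxy] at h
    revert h
    cases T.mat x y <;> cases T'.mat x y <;> decide

theorem ext_sgn {T T' : Tournament V} (h : ∀ x y, sgn T.mat x y = sgn T'.mat x y) : T = T' :=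
  ext_mat <| funext fun _ => funext fun _ => mat_eq_of_sgn_eq (h _ _)

/-- The tournament obtained by reversing all arcs at the vertex `x`. -/
def flip (T : Tournament V) (x : V) : Tournament V where
  Adj v w := ((v = x ∨ w = x) ∧ T.Adj w v) ∨ (¬ (v = x ∨ w = x) ∧ T.Adj v w)
  irrefl v := by
    have := T.irrefl v
    tauto
  adj_iff_not_adj v w h := by
    have := T.adj_iff_not_adj v w h
    tauto

open Classical in
theorem sgn_flip (T : Tournament V) (x v w : V) :
    sgn (T.flip x).mat v w =
      (if v = x then -1 else 1) * (if w = x then -1 else 1) * sgn T.mat v w := by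
  by_cases h : v = w
  · subst h
    rw [sgn_self, sgn_self, mul_zero]
  · have hm : (T.flip x).mat v w = if v = x ∨ w = x then T.mat w v else T.mat v w := by
      rw [Bool.eq_iff_iff, mat_eq_true]
      split_ifs with hx
      · rw [mat_eq_true]
        simp only [flip]
        tauto
      · rw [mat_eq_true]
        simp only [flip]
        tauto
    simp only [sgn, (T.flip x).mat_symm h, hm, T.mat_symm h]
    by_cases hv : v = x <;> by_cases hw : w = x
    · exact absurd (hv.trans hw.symm) h
    all_goals cases T.mat v w <;> simp [hv, hw]

theorem sgn_flip_of_ne (T : Tournament V) {x v w : V} (hv : v ≠ x) (hw : w ≠ x) :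
    sgn (T.flip x).mat v w = sgn T.mat v w := by
  rw [sgn_flip, if_neg hv, if_neg hw, one_mul, one_mul]

theorem sgn_flip_self (T : Tournament V) {x v : V} (hv : v ≠ x) :
    sgn (T.flip x).mat x v = -sgn T.mat x v := by
  rw [sgn_flip, if_pos rfl, if_neg hv, mul_one, neg_one_mul]

theorem flip_flip (T : Tournament V) (x : V) : (T.flip x).flip x = T := by
  classical
  refine ext_sgn fun v w => ?_
  rw [sgn_flip, sgn_flip]
  split_ifs <;> ring

/-- Reversing the arcs at a vertex changes an even number of the signs along every `4`-cycle. -/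
theorem good_flip (T : Tournament V) (u w x y z : V) :
    good (T.flip u).mat w x y z = good T.mat w x y z := by
  classical
  have hsq : ∀ v : V, (if v = u then (-1 : ℤ) else 1) * (if v = u then -1 else 1) = 1 := by
    intro v
    split_ifs <;> norm_num
  unfold good
  simp only [sgn_flip]
  have h1 := hsq w
  have h2 := hsq x
  have h3 := hsq y
  have h4 := hsq z
  generalize (if w = u then (-1 : ℤ) else 1) = a at *
  generalize (if x = u then (-1 : ℤ) else 1) = b at *
  generalize (if y = u then (-1 : ℤ) else 1) = c at *
  generalize (if z = u then (-1 : ℤ) else 1) = d at *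
  have e1 : ∀ p q r s : ℤ, a * b * p * (b * c * q) * (c * d * r) * (d * a * s) = p * q * r * s := by
    intro p q r s
    linear_combination (p * q * r * s) * (b * b * (c * c) * (d * d) * h1 + c * c * (d * d) * h2 +
      d * d * h3 + h4)
  have e2 : ∀ p q r s : ℤ, a * b * p * (b * d * q) * (d * c * r) * (c * a * s) = p * q * r * s := by
    intro p q r s
    linear_combination (p * q * r * s) * (b * b * (c * c) * (d * d) * h1 + c * c * (d * d) * h2 +
      d * d * h3 + h4)
  rw [e1, e2]

theorem AllGood.flip {T : Tournament V} (h : T.AllGood) (x : V) : (T.flip x).AllGood :=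
  fun w y z u => by rw [good_flip]; exact h w y z u

theorem allGood_flip_iff {T : Tournament V} {x : V} : (T.flip x).AllGood ↔ T.AllGood :=
  ⟨fun h => by have := h.flip x; rwa [flip_flip] at this, fun h => h.flip x⟩

/-- The negation of `good` in terms of signs. -/
theorem AllGood.ne_neg_one {T : Tournament V} (h : T.AllGood) (w x y z : V)
    (h1 : sgn T.mat w x * sgn T.mat x y * sgn T.mat y z * sgn T.mat z w = -1) :
    sgn T.mat w x * sgn T.mat x z * sgn T.mat z y * sgn T.mat y w ≠ -1 := by
  intro h2
  have := h w x y z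
  simp [good, h1, h2] at this

/-- After reversing arcs so that `x` dominates, a tournament all of whose quadruples are good is
transitive. The relation `rel T x i j` says that `i` then beats `j`. -/
def rel (T : Tournament V) (x i j : V) : Prop :=
  sgn T.mat x i * sgn T.mat i j * sgn T.mat x j = 1

theorem AllGood.rel_trans {T : Tournament V} (h : T.AllGood) {x i j k : V} (hij : T.rel x i j)
    (hjk : T.rel x j k) : T.rel x i k := by
  unfold rel at *
  have hne : ∀ {a b : V}, sgn T.mat a b ≠ 0 → sgn T.mat a b = 1 ∨ sgn T.mat a b = -1 := by
    intro a b hab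
    refine T.sgn_eq_one_or fun e => hab ?_
    rw [e, sgn_self]
  have e0 : sgn T.mat x i ≠ 0 := fun e => by simp [e] at hij
  have e1 : sgn T.mat i j ≠ 0 := fun e => by simp [e] at hij
  have e2 : sgn T.mat x j ≠ 0 := fun e => by simp [e] at hij
  have e3 : sgn T.mat j k ≠ 0 := fun e => by simp [e] at hjk
  have e4 : sgn T.mat x k ≠ 0 := fun e => by simp [e] at hjk
  have hik : i ≠ k := by
    rintro rfl
    have := T.sgn_symm i j
    rcases hne e0 with a | a <;> rcases hne e1 with b | b <;> rcases hne e2 with c | c <;>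
      simp_all
  have hg := h.ne_neg_one x i j k
  rw [T.sgn_symm x k, T.sgn_symm x j, T.sgn_symm j k] at hg
  rcases hne e0 with a | a <;> rcases hne e1 with b | b <;> rcases hne e2 with c | c <;>
    rcases hne e3 with d | d <;> rcases hne e4 with e | e <;>
    rcases T.sgn_eq_one_or hik with f | f <;> simp_all

theorem not_rel_self (T : Tournament V) (x i : V) : ¬ T.rel x i i := by
  simp [rel, sgn_self]

theorem rel_or_rel (T : Tournament V) {x i j : V} (hi : i ≠ x) (hj : j ≠ x) (hij : i ≠ j) :
    T.rel x i j ∨ T.rel x j i := by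
  unfold rel
  rw [T.sgn_symm i j]
  rcases T.sgn_eq_one_or hi.symm with a | a <;> rcases T.sgn_eq_one_or hj.symm with b | b <;>
    rcases T.sgn_eq_one_or hij with c | c <;> simp [a, b, c]

/-- The relation `rel T x` has a first and a last element. -/
theorem AllGood.exists_first_last [Finite V] {T : Tournament V} (h : T.AllGood) {x y : V}
    (hy : y ≠ x) : ∃ f l, f ≠ x ∧ l ≠ x ∧ (∀ i, i ≠ x → i ≠ f → T.rel x f i) ∧
      ∀ i, i ≠ x → i ≠ l → T.rel x i l := by
  let r : {i // i ≠ x} → {i // i ≠ x} → Prop := fun i j => T.rel x i j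
  have : IsTrans _ r := ⟨fun _ _ _ hij hjk => h.rel_trans hij hjk⟩
  have : Std.Irrefl r := ⟨fun i => T.not_rel_self x i⟩
  have : IsTrans _ (Function.swap r) := ⟨fun _ _ _ hij hjk => h.rel_trans hjk hij⟩
  have : Std.Irrefl (Function.swap r) := ⟨fun i => T.not_rel_self x i⟩
  obtain ⟨f, -, hf⟩ := (Finite.wellFounded_of_trans_of_irrefl r).has_min Set.univ ⟨⟨y, hy⟩, trivial⟩
  obtain ⟨l, -, hl⟩ :=
    (Finite.wellFounded_of_trans_of_irrefl (Function.swap r)).has_min Set.univ ⟨⟨y, hy⟩, trivial⟩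
  refine ⟨f, l, f.2, l.2, fun i hi hif => ?_, fun i hi hil => ?_⟩
  · exact (T.rel_or_rel f.2 hi (Ne.symm hif)).resolve_right (hf ⟨i, hi⟩ trivial)
  · exact (T.rel_or_rel hi l.2 hil).resolve_right (hl ⟨i, hi⟩ trivial)

/-- Let `U` have good quadruples and agree with `T` off `x`. If the arcs from `x` to the first and
to the last vertex are both equal or both reversed, then so are all arcs at `x`: a vertex `i` between
them with a different behaviour makes `x, f, i, l` a bad quadruple of `U`. -/
theorem AllGood.sgn_mul_eq {T U : Tournament V} (hU : U.AllGood) {x f l : V}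
    (hfx : f ≠ x) (hlx : l ≠ x) (hf : ∀ i, i ≠ x → i ≠ f → T.rel x f i)
    (hl : ∀ i, i ≠ x → i ≠ l → T.rel x i l)
    (hoff : ∀ i j, i ≠ x → j ≠ x → sgn U.mat i j = sgn T.mat i j)
    (hfl : sgn T.mat x f * sgn U.mat x f = sgn T.mat x l * sgn U.mat x l) {i : V} (hi : i ≠ x) :
    sgn T.mat x i * sgn U.mat x i = sgn T.mat x f * sgn U.mat x f := by
  by_contra hne
  have hif : i ≠ f := by rintro rfl; exact hne rfl
  have hil : i ≠ l := by rintro rfl; exact hne hfl.symm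
  have h1 := hf i hi hif
  have h2 := hl i hi hil
  have hlf : l ≠ f := by
    rintro rfl
    unfold rel at h1 h2
    rw [T.sgn_symm l i] at h2
    linarith
  have h3 := hf l hlx hlf
  have hg := hU.ne_neg_one x f i l
  rw [U.sgn_symm x l, U.sgn_symm x i, U.sgn_symm i l, hoff f i hfx hi, hoff i l hi hlx,
    hoff f l hfx hlx] at hg
  have hsq : ∀ {W : Tournament V} {j : V}, j ≠ x → sgn W.mat x j * sgn W.mat x j = 1 := by
    intro W j hj
    rcases W.sgn_eq_one_or hj.symm with a | a <;> rw [a] <;> norm_num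
  have hsolve : ∀ {j k : V}, j ≠ x → k ≠ x → T.rel x j k →
      sgn T.mat j k = sgn T.mat x j * sgn T.mat x k := by
    intro j k hj hk hjk
    unfold rel at hjk
    linear_combination (sgn T.mat x j * sgn T.mat x k) * hjk -
      sgn T.mat x k * sgn T.mat x k * sgn T.mat j k * hsq (W := T) hj -
      sgn T.mat j k * hsq (W := T) hk
  rw [hsolve hfx hi h1, hsolve hi hlx h2, hsolve hfx hlx h3] at hg
  have hv : (sgn T.mat x f * sgn U.mat x f) * (sgn T.mat x f * sgn U.mat x f) = 1 := by
    linear_combination sgn T.mat x f * sgn T.mat x f * hsq (W := U) hfx + hsq (W := T) hfx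
  have hw : sgn T.mat x i * sgn U.mat x i = -(sgn T.mat x f * sgn U.mat x f) := by
    rcases T.sgn_eq_one_or hfx.symm with a | a <;> rcases T.sgn_eq_one_or hi.symm with c | c <;>
      rcases U.sgn_eq_one_or hfx.symm with d | d <;> rcases U.sgn_eq_one_or hi.symm with g | g <;>
      rw [a, c, d, g] at hne ⊢ <;> first | rfl | exact absurd rfl hne
  refine hg ?_ ?_
  · linear_combination -(sgn T.mat x f * sgn U.mat x f) * (sgn T.mat x l * sgn U.mat x l) *
      hsq (W := T) hi + (sgn T.mat x f * sgn U.mat x f) * hfl - hv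
  · linear_combination (sgn T.mat x f * sgn U.mat x f) * (sgn T.mat x i * sgn U.mat x i) *
      hsq (W := T) hlx + (sgn T.mat x f * sgn U.mat x f) * hw - hv

theorem eq_of_sgn {T U : Tournament V} {x : V}
    (hoff : ∀ i j, i ≠ x → j ≠ x → sgn U.mat i j = sgn T.mat i j)
    (h : ∀ i, i ≠ x → sgn U.mat x i = sgn T.mat x i) : U = T := by
  refine ext_sgn fun i j => ?_
  by_cases hi : i = x <;> by_cases hj : j = x
  · rw [hi, hj, sgn_self, sgn_self]
  · rw [hi]
    exact h j hj
  · rw [hj, sgn_symm, h i hi, ← sgn_symm]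
  · exact hoff i j hi hj

end Tournament

/-! ### The carousel law is unique -/

namespace ExchangeableLaw

variable {μ : ExchangeableLaw} {V W : Type} [Fintype V] [Fintype W]

open Classical in
/-- The probability that the random tournament on `V` is `T`. -/
noncomputable def prob (μ : ExchangeableLaw) {V : Type} [Fintype V] (T : Tournament V) : ℝ :=
  μ.E V fun U => if U = T then 1 else 0

theorem E_eq_sum_prob (μ : ExchangeableLaw) (g : Tournament V → ℝ) :
    μ.E V g = ∑ T, g T * μ.prob T := by
  classical
  unfold prob
  simp only [← E_const_mul]
  rw [← E_sum]
  congr 1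
  funext U
  simp

theorem prob_comap_equiv (μ : ExchangeableLaw) (T : Tournament W) (e : V ≃ W) :
    μ.prob (T.comap e.toEmbedding) = μ.prob T := by
  unfold prob
  rw [← μ.comap _ _ e.toEmbedding]
  congr 1
  funext U
  congr 1
  refine propext ⟨fun h => ?_, fun h => by rw [h]⟩
  have h' : (U.comap e.toEmbedding).comap e.symm.toEmbedding =
    (T.comap e.toEmbedding).comap e.symm.toEmbedding := by rw [h]
  rw [Tournament.comap_comap, Tournament.comap_comap] at h'
  have he : e.symm.toEmbedding.trans e.toEmbedding = Function.Embedding.refl W := by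
    ext w
    simp
  rw [he] at h'
  exact h'

theorem prob_eq_of_isom (μ : ExchangeableLaw) {T : Tournament V} {T' : Tournament W}
    (h : T.Isom T') : μ.prob T = μ.prob T' := by
  obtain ⟨e, rfl⟩ := isom_iff_exists_equiv.1 h
  exact μ.prob_comap_equiv T' e

namespace IsCarousel

open Classical in
/-- Some quadruple on `V` is bad with probability zero. -/
theorem E_not_allGood (h : μ.IsCarousel) :
    μ.E V (fun T => if T.AllGood then 0 else 1) = 0 := by
  have hsum : μ.E V (fun T => ∑ f : Fin 4 ↪ V,
      if good (T.comap f).mat 0 1 2 3 = true then (0 : ℝ) else 1) = 0 := by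
    rw [E_sum]
    refine Finset.sum_eq_zero fun f _ => ?_
    exact (μ.comap _ _ f fun T => if good T.mat 0 1 2 3 = true then (0 : ℝ) else 1).trans h.good_ae
  have hnn : ∀ (T : Tournament V) (f : Fin 4 ↪ V),
      (0 : ℝ) ≤ if good (T.comap f).mat 0 1 2 3 = true then 0 else 1 := fun T f => by
    split_ifs <;> norm_num
  refine μ.E_eq_zero_of_le (fun T => by split_ifs <;> norm_num) (fun T => ?_) hsum
  split_ifs with hT
  · exact Finset.sum_nonneg fun f _ => hnn T f
  · simp only [AllGood, not_forall] at hT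
    obtain ⟨w, x, y, z, hg⟩ := hT
    have hd := mt (T.good_of_not_distinct (w := w) (x := x) (y := y) (z := z)) hg
    push Not at hd
    obtain ⟨h1, h2, h3, h4, h5, h6⟩ := hd
    have hinj : Function.Injective ![w, x, y, z] := by
      intro i j hij
      fin_cases i <;> fin_cases j <;> simp_all
    refine le_trans ?_ (Finset.single_le_sum (fun f _ => hnn T f) (Finset.mem_univ ⟨_, hinj⟩))
    have : ¬ good (T.comap ⟨_, hinj⟩).mat 0 1 2 3 = true := hg
    rw [if_neg this]

/-- Expectations only depend on the values at tournaments with good quadruples. -/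
theorem E_congr (h : μ.IsCarousel) {g g' : Tournament V → ℝ}
    (hg : ∀ T : Tournament V, T.AllGood → g T = g' T) : μ.E V g = μ.E V g' := by
  classical
  have key : μ.E V (fun T => |g T - g' T|) = 0 := by
    refine μ.E_eq_zero_of_le (g' := fun T => (∑ U, |g U - g' U|) * if T.AllGood then 0 else 1)
      (fun T => abs_nonneg _) (fun T => ?_) ?_
    · split_ifs with hT
      · simp [hg T hT]
      · rw [mul_one]
        exact Finset.single_le_sum (f := fun U => |g U - g' U|) (fun U _ => abs_nonneg _)
          (Finset.mem_univ T)
    · rw [E_const_mul, h.E_not_allGood, mul_zero]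
  have h1 : μ.E V (fun T => g T - g' T) ≤ 0 := key ▸ μ.mono fun T => le_abs_self _
  have h2 : μ.E V (fun T => g' T - g T) ≤ 0 := key ▸ μ.mono fun T => by
    rw [abs_sub_comm]
    exact le_abs_self _
  rw [E_sub] at h1 h2
  linarith

theorem prob_eq_zero (h : μ.IsCarousel) {T : Tournament V} (hT : ¬ T.AllGood) :
    μ.prob T = 0 := by
  classical
  rw [prob, h.E_congr (g' := fun _ => 0), E_const]
  intro U hU
  rw [if_neg]
  rintro rfl
  exact hT hU

/-- The sign of an arc at `x` is uncorrelated with everything that does not involve `x`. -/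
theorem E_mul_sgn (h : μ.IsCarousel) {x i : V} (hi : i ≠ x)
    (g : Tournament {y // y ≠ x} → ℝ) :
    μ.E V (fun T => g (T.comap (Function.Embedding.subtype _)) * (sgn T.mat x i : ℝ)) = 0 := by
  classical
  let e : {y // y ≠ x} ⊕ Unit ↪ V := ⟨Sum.elim Subtype.val fun _ => x,
    Function.Injective.sumElim Subtype.val_injective (fun _ _ _ => rfl) fun a _ => a.2⟩
  have h0 := μ.comap (Fin 3) ({y // y ≠ x} ⊕ Unit × Fin 2)
    ⟨![.inl ⟨i, hi⟩, .inr ((), 0), .inr ((), 1)], by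
      intro a b hab
      fin_cases a <;> fin_cases b <;> simp_all⟩
    fun T => ((sgn T.mat 0 1 * sgn T.mat 0 2 : ℤ) : ℝ)
  rw [h.balanced] at h0
  have h1 := μ.E_mul_eq_zero (A := {y // y ≠ x}) (B := Unit)
    (fun T => (sgn T.mat (.inr ()) (.inl ⟨i, hi⟩) : ℝ)) (by
      rw [← h0]
      congr 1
      funext T
      have e0 := (T.comap (copy {y // y ≠ x} Unit 0)).sgn_symm (.inl ⟨i, hi⟩) (.inr ())
      have e1 := (T.comap (copy {y // y ≠ x} Unit 1)).sgn_symm (.inl ⟨i, hi⟩) (.inr ())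
      rw [← Int.cast_mul, e0, e1, neg_mul_neg]
      rfl) g
  rw [← μ.comap _ _ e] at h1
  exact h1

/-- The law is invariant under reversing the arcs at a vertex: the difference of the two probabilities
is a combination of two expectations that vanish by `E_mul_sgn`. -/
theorem prob_flip (h : μ.IsCarousel) (T : Tournament V) (x : V) :
    μ.prob (T.flip x) = μ.prob T := by
  classical
  by_cases hT : T.AllGood
  swap
  · rw [h.prob_eq_zero hT, h.prob_eq_zero (mt allGood_flip_iff.1 hT)]
  by_cases hy : ∃ y, y ≠ x
  swap
  · push Not at hy
    rw [ext_sgn (T := T.flip x) (T' := T)]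
    intro v w
    rw [hy v, hy w, sgn_self, sgn_self]
  obtain ⟨y, hy⟩ := hy
  obtain ⟨f, l, hfx, hlx, hf, hl⟩ := hT.exists_first_last hy
  let g : Tournament {y // y ≠ x} → ℝ := fun U =>
    if U = T.comap (Function.Embedding.subtype _) then 1 else 0
  have hg : ∀ U : Tournament V, U.comap (Function.Embedding.subtype fun y => y ≠ x) =
      T.comap (Function.Embedding.subtype _) ↔
        ∀ i j, i ≠ x → j ≠ x → sgn U.mat i j = sgn T.mat i j := by
    intro U
    constructor
    · intro hU i j hi hj
      exact congrArg (fun S : Tournament {y // y ≠ x} => sgn S.mat ⟨i, hi⟩ ⟨j, hj⟩) hU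
    · intro hU
      exact ext_sgn fun i j => hU i j i.2 j.2
  have hz : μ.E V (fun U => (sgn T.mat x f : ℝ) *
      (g (U.comap (Function.Embedding.subtype _)) * (sgn U.mat x f : ℝ)) + (sgn T.mat x l : ℝ) *
      (g (U.comap (Function.Embedding.subtype _)) * (sgn U.mat x l : ℝ))) = 0 := by
    rw [E_add, E_const_mul, E_const_mul, h.E_mul_sgn hfx, h.E_mul_sgn hlx]
    norm_num
  have hne : T ≠ T.flip x := by
    intro e
    have h1 := T.sgn_flip_self hfx
    rw [← e] at h1
    rcases T.sgn_eq_one_or hfx.symm with a | a <;> rw [a] at h1 <;> norm_num at h1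
  have hsq : ∀ {W : Tournament V} {j : V}, j ≠ x → sgn W.mat x j * sgn W.mat x j = 1 := by
    intro W j hj
    rcases W.sgn_eq_one_or hj.symm with a | a <;> rw [a] <;> norm_num
  -- Off the event that `U` agrees with `T` off `x` both sides vanish. On this event the two terms on
  -- the left cancel, unless the arcs to `f` and `l` are both those of `T` or both reversed.
  have hcongr : μ.E V (fun U => (sgn T.mat x f : ℝ) *
      (g (U.comap (Function.Embedding.subtype _)) * (sgn U.mat x f : ℝ)) + (sgn T.mat x l : ℝ) *
      (g (U.comap (Function.Embedding.subtype _)) * (sgn U.mat x l : ℝ))) =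
      μ.E V (fun U => 2 * (if U = T then 1 else 0) - 2 * (if U = T.flip x then 1 else 0)) := by
    refine h.E_congr fun U hU => ?_
    by_cases hoff : ∀ i j, i ≠ x → j ≠ x → sgn U.mat i j = sgn T.mat i j
    · have hgU : g (U.comap (Function.Embedding.subtype _)) = 1 := if_pos ((hg U).2 hoff)
      rw [hgU]
      have hT' : U = T → sgn T.mat x f * sgn U.mat x f = 1 ∧ sgn T.mat x l * sgn U.mat x l = 1 := by
        rintro rfl
        exact ⟨hsq hfx, hsq hlx⟩
      have hF' : U = T.flip x →
          sgn T.mat x f * sgn U.mat x f = -1 ∧ sgn T.mat x l * sgn U.mat x l = -1 := by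
        rintro rfl
        rw [T.sgn_flip_self hfx, T.sgn_flip_self hlx, mul_neg, mul_neg, hsq hfx, hsq hlx]
        exact ⟨rfl, rfl⟩
      have hpm : ∀ j, j ≠ x → sgn T.mat x j * sgn U.mat x j = 1 ∨
          sgn T.mat x j * sgn U.mat x j = -1 := by
        intro j hj
        rcases T.sgn_eq_one_or hj.symm with a | a <;>
          rcases U.sgn_eq_one_or hj.symm with b | b <;> rw [a, b] <;> norm_num
      have hval : (sgn T.mat x f : ℝ) * (1 * (sgn U.mat x f : ℝ)) +
          (sgn T.mat x l : ℝ) * (1 * (sgn U.mat x l : ℝ)) =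
          ((sgn T.mat x f * sgn U.mat x f + sgn T.mat x l * sgn U.mat x l : ℤ) : ℝ) := by
        push_cast
        ring
      rw [hval]
      by_cases hfl : sgn T.mat x f * sgn U.mat x f = sgn T.mat x l * sgn U.mat x l
      · have hall := fun i hi => hU.sgn_mul_eq hfx hlx hf hl hoff hfl (i := i) hi
        rcases hpm f hfx with hv | hv
        · have hUT : U = T := eq_of_sgn hoff fun i hi => by
            have := hall i hi
            rw [hv] at this
            linear_combination sgn T.mat x i * this - sgn U.mat x i * hsq (W := T) hi
          rw [if_pos hUT, if_neg (fun e => hne (hUT.symm.trans e)), ← hfl, hv]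
          norm_num
        · have hUT : U = T.flip x := eq_of_sgn
            (fun i j hi hj => by rw [T.sgn_flip_of_ne hi hj, hoff i j hi hj]) fun i hi => by
            have := hall i hi
            rw [hv] at this
            rw [T.sgn_flip_self hi]
            linear_combination sgn T.mat x i * this - sgn U.mat x i * hsq (W := T) hi
          rw [if_pos hUT, if_neg (fun e => hne (e.symm.trans hUT)), ← hfl, hv]
          norm_num
      · rw [if_neg, if_neg]
        · rcases hpm f hfx with a | a <;> rcases hpm l hlx with b | b <;> rw [a, b] at hfl ⊢ <;>
            simp at hfl ⊢
        · intro e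
          exact hfl ((hF' e).1.trans (hF' e).2.symm)
        · intro e
          exact hfl ((hT' e).1.trans (hT' e).2.symm)
    · have hgU : g (U.comap (Function.Embedding.subtype _)) = 0 := if_neg fun e => hoff ((hg U).1 e)
      rw [hgU, if_neg, if_neg]
      · norm_num
      · rintro rfl
        exact hoff fun i j hi hj => T.sgn_flip_of_ne hi hj
      · rintro rfl
        exact hoff fun _ _ _ _ => rfl
  rw [hcongr, E_sub, E_const_mul, E_const_mul] at hz
  change 2 * μ.prob T - 2 * μ.prob (T.flip x) = 0 at hz
  linarith

theorem E_flip (h : μ.IsCarousel) (x : V) (g : Tournament V → ℝ) :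
    μ.E V (fun T => g (T.flip x)) = μ.E V g := by
  rw [E_eq_sum_prob, E_eq_sum_prob]
  refine Fintype.sum_equiv ⟨fun T => T.flip x, fun T => T.flip x, fun T => T.flip_flip x,
    fun T => T.flip_flip x⟩ _ _ fun T => ?_
  rw [← h.prob_flip T x]
  rfl

end IsCarousel

end ExchangeableLaw

namespace Tournament

/-- A tournament with a transitive arc relation is the transitive tournament. -/
theorem isom_transitive {V : Type*} [Fintype V] (T : Tournament V)
    (h : ∀ i j k, T.Adj i j → T.Adj j k → T.Adj i k) :
    T.Isom (transitive (Fin (Fintype.card V))) := by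
  classical
  have : IsTrans V T.Adj := ⟨h⟩
  have : Std.Irrefl T.Adj := ⟨T.irrefl⟩
  have : Std.Trichotomous T.Adj := ⟨fun a b hab hba => by
    by_contra hne
    exact hab ((T.adj_iff_not_adj a b hne).2 hba)⟩
  have : IsStrictTotalOrder V T.Adj := {}
  let _ : LinearOrder V := linearOrderOfSTO T.Adj
  have e : Fin (Fintype.card V) ≃o V := Fintype.orderIsoFinOfCardEq V rfl
  exact Isom.symm ⟨⟨e.toEquiv, e.lt_iff_lt⟩⟩

theorem isoInd_nonneg {V W : Type*} (T : Tournament V) (U : Tournament W) : 0 ≤ T.isoInd U := by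
  unfold isoInd
  split_ifs <;> norm_num

end Tournament

namespace ExchangeableLaw

variable {μ ν : ExchangeableLaw} {V : Type} [Fintype V]

namespace IsCarousel

/-- Reversing arcs at vertices other than `x` makes `x` dominate. The induction is on the number of
vertices that beat `x`. -/
theorem exists_dominating (h : μ.IsCarousel) (x : V) (n : ℕ) : ∀ T : Tournament V, T.AllGood →
    {i | i ≠ x ∧ sgn T.mat x i ≠ 1}.ncard = n →
    ∃ T' : Tournament V, T'.AllGood ∧ μ.prob T' = μ.prob T ∧ ∀ i, i ≠ x → sgn T'.mat x i = 1 := by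
  induction n with
  | zero =>
    intro T hT hn
    rw [Set.ncard_eq_zero] at hn
    refine ⟨T, hT, rfl, fun i hi => ?_⟩
    by_contra hne
    exact (Set.ext_iff.1 hn i).1 ⟨hi, hne⟩
  | succ n ih =>
    intro T hT hn
    have hne : {i | i ≠ x ∧ sgn T.mat x i ≠ 1}.Nonempty := by
      rw [← Set.ncard_pos, hn]
      exact n.succ_pos
    obtain ⟨i, hi⟩ := hne
    have hi1 : sgn T.mat x i = -1 := (T.sgn_eq_one_or hi.1.symm).resolve_left hi.2
    have hset : {j | j ≠ x ∧ sgn (T.flip i).mat x j ≠ 1} =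
        {j | j ≠ x ∧ sgn T.mat x j ≠ 1} \ {i} := by
      ext j
      simp only [Set.mem_ofPred_eq, Set.mem_sdiff, Set.mem_singleton_iff]
      by_cases hj : j = i
      · subst hj
        rw [sgn_symm, T.sgn_flip_self hi.1.symm, neg_neg, sgn_symm, hi1]
        simp
      · rw [T.sgn_flip_of_ne hi.1.symm hj]
        simp [hj]
    obtain ⟨T', h1, h2, h3⟩ := ih (T.flip i) (hT.flip i) (by
      rw [hset, Set.ncard_sdiff_singleton_of_mem hi, hn]
      rfl)
    exact ⟨T', h1, h2.trans (h.prob_flip T i), h3⟩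

/-- All locally transitive labelled tournaments have the same probability. -/
theorem prob_eq_transitive (h : μ.IsCarousel) {T : Tournament V} (hT : T.AllGood) :
    μ.prob T = μ.prob (transitive (Fin (Fintype.card V))) := by
  rcases isEmpty_or_nonempty V with hV | ⟨⟨x⟩⟩
  · exact μ.prob_eq_of_isom (T.isom_transitive fun i => hV.elim i)
  obtain ⟨T', h1, h2, h3⟩ := h.exists_dominating x _ T hT rfl
  rw [← h2]
  have hadj : ∀ i j, T'.Adj i j ↔ sgn T'.mat i j = 1 := by
    intro i j
    by_cases hij : i = j
    · subst hij
      simp [T'.irrefl i, sgn_self]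
    · rw [← mat_eq_true]
      simp only [sgn, T'.mat_symm hij]
      cases T'.mat i j <;> decide
  have hx : ∀ i, ¬ T'.Adj i x := by
    intro i hix
    by_cases hi : i = x
    · subst hi
      exact T'.irrefl i hix
    · rw [T'.adj_iff_not_adj i x hi, hadj] at hix
      exact hix (h3 i hi)
  refine μ.prob_eq_of_isom (T'.isom_transitive fun i j k hij hjk => ?_)
  have hj : j ≠ x := by rintro rfl; exact hx _ hij
  have hk : k ≠ x := by rintro rfl; exact hx _ hjk
  by_cases hi : i = x
  · rw [hi, hadj]
    exact h3 k hk
  · have hrel : ∀ a b, a ≠ x → b ≠ x → (T'.rel x a b ↔ T'.Adj a b) := by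
      intro a b ha hb
      rw [rel, h3 a ha, h3 b hb, one_mul, mul_one, hadj]
    rw [← hrel i k hi hk]
    exact h1.rel_trans ((hrel i j hi hj).2 hij) ((hrel j k hj hk).2 hjk)

/-- There is only one carousel law. -/
theorem E_unique (h : μ.IsCarousel) (h' : ν.IsCarousel) (g : Tournament V → ℝ) :
    μ.E V g = ν.E V g := by
  classical
  have hprob : ∀ {ρ : ExchangeableLaw}, ρ.IsCarousel → ∀ T : Tournament V, ρ.prob T =
      (if T.AllGood then 1 else 0) * ρ.prob (transitive (Fin (Fintype.card V))) := by
    intro ρ hρ T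
    split_ifs with hT
    · rw [one_mul, hρ.prob_eq_transitive hT]
    · rw [zero_mul, hρ.prob_eq_zero hT]
  have hone : ∀ {ρ : ExchangeableLaw}, ρ.IsCarousel →
      (∑ T : Tournament V, if T.AllGood then (1 : ℝ) else 0) *
        ρ.prob (transitive (Fin (Fintype.card V))) = 1 := by
    intro ρ hρ
    have h1 := ρ.one V
    rw [E_eq_sum_prob] at h1
    refine Eq.trans ?_ h1
    rw [Finset.sum_mul]
    refine Finset.sum_congr rfl fun T _ => ?_
    rw [hprob hρ T, Pi.one_apply, one_mul]
  have hc : μ.prob (transitive (Fin (Fintype.card V))) =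
      ν.prob (transitive (Fin (Fintype.card V))) := by
    have h1 := hone h
    have h2 := hone h'
    refine mul_left_cancel₀ (left_ne_zero_of_mul_eq_one h1) (h1.trans h2.symm)
  rw [E_eq_sum_prob, E_eq_sum_prob]
  refine Finset.sum_congr rfl fun T _ => ?_
  rw [hprob h, hprob h', hc]

end IsCarousel

/-! ### Independence of disjoint parts under the carousel law -/

/-- The law of the tournament off a finite set `A` of vertices after reweighting by a nonnegative
function `w` of the tournament on `A`. -/
noncomputable def reweight (μ : ExchangeableLaw) {A : Type} [Fintype A] (w : Tournament A → ℝ)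
    (hw : ∀ T, 0 ≤ w T) (hp : μ.E A w ≠ 0) : ExchangeableLaw where
  E V _ :=
    { toFun := fun g => (μ.E A w)⁻¹ * μ.E (A ⊕ V) fun T =>
        w (T.comap Function.Embedding.inl) * g (T.comap Function.Embedding.inr)
      map_add' := fun g g' => by
        simp only [Pi.add_apply, mul_add, E_add]
      map_smul' := fun c g => by
        simp only [Pi.smul_apply, smul_eq_mul, mul_left_comm _ c, E_const_mul, RingHom.id_apply] }
  nonneg V _ g hg := mul_nonneg (inv_nonneg.2 (μ.nonneg _ _ hw))
    (μ.nonneg _ _ fun T => mul_nonneg (hw _) (hg _))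
  one V _ := by
    have := μ.comap A (A ⊕ V) Function.Embedding.inl w
    simp only [LinearMap.coe_mk, AddHom.coe_mk, Pi.one_apply, mul_one, this]
    exact inv_mul_cancel₀ hp
  comap V W _ _ f g := by
    have := μ.comap (A ⊕ V) (A ⊕ W) (Function.Embedding.sumMap (Function.Embedding.refl A) f)
      fun T => w (T.comap Function.Embedding.inl) * g (T.comap Function.Embedding.inr)
    simp only [LinearMap.coe_mk, AddHom.coe_mk]
    rw [← this]
    rfl

variable {A : Type} [Fintype A]

/-- Reweighting keeps the carousel properties: for the balance off `A`, this is because the signs at a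
vertex off `A` are uncorrelated with the tournament on `A`. -/
theorem IsCarousel.reweight (h : μ.IsCarousel) (w : Tournament A → ℝ) (hw : ∀ T, 0 ≤ w T)
    (hp : μ.E A w ≠ 0) : (μ.reweight w hw hp).IsCarousel := by
  constructor
  · change (μ.E A w)⁻¹ * μ.E (A ⊕ Fin 3) _ = 0
    rw [mul_eq_zero]
    right
    have key := h.E_mul_sgn (V := A ⊕ Fin 3) (x := .inr 1) (i := .inr 0) (by simp)
      fun U => -(w (U.comap ⟨fun a => ⟨.inl a, by simp⟩, fun a b hab => by simpa using hab⟩) *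
        (sgn U.mat ⟨.inr 0, by simp⟩ ⟨.inr 2, by simp⟩ : ℝ))
    rw [← key]
    congr 1
    funext T
    have e := T.sgn_symm (.inr 0) (.inr 1)
    rw [e]
    change w (T.comap Function.Embedding.inl) *
        ((sgn T.mat (.inr 0) (.inr 1) * sgn T.mat (.inr 0) (.inr 2) : ℤ) : ℝ) =
      -(w (T.comap Function.Embedding.inl) * (sgn T.mat (.inr 0) (.inr 2) : ℝ)) *
        ((-sgn T.mat (.inr 0) (.inr 1) : ℤ) : ℝ)
    push_cast
    ring
  · change (μ.E A w)⁻¹ * μ.E (A ⊕ Fin 4) _ = 0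
    rw [mul_eq_zero]
    right
    have h1 := μ.comap (Fin 4) (A ⊕ Fin 4) Function.Embedding.inr
      fun T => if good T.mat 0 1 2 3 = true then (0 : ℝ) else 1
    rw [h.good_ae] at h1
    have hle : ∀ T : Tournament A, w T ≤ ∑ U, w U := fun T =>
      Finset.single_le_sum (fun U _ => hw U) (Finset.mem_univ T)
    refine μ.E_eq_zero_of_le (fun T => mul_nonneg (hw _) (by dsimp only; split_ifs <;> norm_num))
      (fun T => mul_le_mul_of_nonneg_right (hle _) (by dsimp only; split_ifs <;> norm_num)) ?_
    rw [E_const_mul, h1, mul_zero]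

/-- Disjoint parts of the random carousel are independent: reweighting by the tournament on `A`
yields a carousel law again, and there is only one. -/
theorem IsCarousel.E_mul (h : μ.IsCarousel) (w : Tournament A → ℝ) (hw : ∀ T, 0 ≤ w T)
    (g : Tournament V → ℝ) (hg : ∀ T, 0 ≤ g T) :
    μ.E (A ⊕ V) (fun T =>
      w (T.comap Function.Embedding.inl) * g (T.comap Function.Embedding.inr)) =
      μ.E A w * μ.E V g := by
  by_cases hp : μ.E A w = 0
  · rw [hp, zero_mul]
    have h1 := μ.comap A (A ⊕ V) Function.Embedding.inl w
    rw [hp] at h1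
    have hle : ∀ T : Tournament V, g T ≤ ∑ U, g U := fun T =>
      Finset.single_le_sum (fun U _ => hg U) (Finset.mem_univ T)
    refine μ.E_eq_zero_of_le (fun T => mul_nonneg (hw _) (hg _))
      (g' := fun T => (∑ U, g U) * w (T.comap Function.Embedding.inl)) (fun T => ?_) ?_
    · rw [mul_comm]
      exact mul_le_mul_of_nonneg_right (hle _) (hw _)
    · rw [E_const_mul, h1, mul_zero]
  · have := (h.reweight w hw hp).E_unique h g
    change (μ.E A w)⁻¹ * _ = _ at this
    rw [← this, mul_inv_cancel_left₀ hp]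

/-! ### The densities under the carousel law -/

/-- A product over the pair `3`, `4` changes its sign when the arcs at `3` are reversed. -/
theorem splitTerm_flip (s p l : ℤ) (T : Tournament (Fin 5)) :
    splitTerm s p l (T.flip 3).mat 0 1 2 3 4 = -splitTerm s p l T.mat 0 1 2 3 4 := by
  have hm : ∀ i j : Fin 5, i ≠ 3 → j ≠ 3 → (T.flip 3).mat i j = T.mat i j := fun i j hi hj =>
    mat_eq_of_sgn_eq (T.sgn_flip_of_ne hi hj)
  have hs : ∀ i : Fin 5, i ≠ 3 → sgn (T.flip 3).mat 3 i = -sgn T.mat 3 i := fun i hi =>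
    T.sgn_flip_self hi
  have hs' : ∀ i : Fin 5, i ≠ 3 → sgn (T.flip 3).mat 4 i = sgn T.mat 4 i := fun i hi =>
    T.sgn_flip_of_ne (by decide) hi
  have hc : cyc (T.flip 3).mat 0 1 2 = cyc T.mat 0 1 2 := by
    unfold cyc
    rw [hm 0 1 (by decide) (by decide), hm 1 2 (by decide) (by decide),
      hm 2 0 (by decide) (by decide), hm 1 0 (by decide) (by decide),
      hm 2 1 (by decide) (by decide), hm 0 2 (by decide) (by decide)]
  unfold splitTerm signProd
  rw [hc, hs 0 (by decide), hs 1 (by decide), hs 2 (by decide), hs' 0 (by decide),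
    hs' 1 (by decide), hs' 2 (by decide)]
  split_ifs <;> ring

/-- The carousel laws attain the upper bound. -/
theorem IsCarousel.mul_dens_eq {T₀ : Tournament (Fin 5)} {N M r s p l : ℤ} (h : μ.IsCarousel)
    (hT₀ : T₀.HasLocalBound N M r s p l) : M * μ.dens T₀ = N := by
  have h1 : μ.E (Fin 5) (fun T => (N : ℝ) - M * T₀.isoInd T - (squares r s p l T.mat : ℤ)) = 0 := by
    rw [h.E_congr (g' := fun _ => 0), E_const]
    exact fun T hT => (hT₀.spec T).2 hT.mat_allGood
  have h2 : μ.E (Fin 5) (fun T => (rootProd T.mat 0 1 2 3 4 : ℝ)) = 0 := by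
    have key := h.E_mul_sgn (V := Fin 5) (x := 1) (i := 0) (by decide)
      fun U => -((sgn U.mat ⟨(0 : Fin 5), by decide⟩ ⟨(2 : Fin 5), by decide⟩ *
        (sgn U.mat ⟨(0 : Fin 5), by decide⟩ ⟨(3 : Fin 5), by decide⟩ *
          sgn U.mat ⟨(0 : Fin 5), by decide⟩ ⟨(4 : Fin 5), by decide⟩) : ℤ) : ℝ)
    rw [← key]
    congr 1
    funext T
    have e := T.sgn_symm 0 1
    rw [e]
    change ((sgn T.mat 0 1 * sgn T.mat 0 2 * (sgn T.mat 0 3 * sgn T.mat 0 4) : ℤ) : ℝ) =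
      -((sgn T.mat 0 2 * (sgn T.mat 0 3 * sgn T.mat 0 4) : ℤ) : ℝ) * ((-sgn T.mat 0 1 : ℤ) : ℝ)
    push_cast
    ring
  have h3 : μ.E (Fin 5) (fun T => (splitTerm s p l T.mat 0 1 2 3 4 : ℝ)) = 0 := by
    have key := h.E_flip (3 : Fin 5) fun T => (splitTerm s p l T.mat 0 1 2 3 4 : ℝ)
    simp only [splitTerm_flip, Int.cast_neg] at key
    have : μ.E (Fin 5) (fun T => -(splitTerm s p l T.mat 0 1 2 3 4 : ℝ)) =
        -μ.E (Fin 5) (fun T => (splitTerm s p l T.mat 0 1 2 3 4 : ℝ)) := (μ.E (Fin 5)).map_neg _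
    linarith
  simp only [squares, Int.cast_add, Int.cast_mul, E_sub, E_add, E_const_mul, E_const] at h1
  rw [μ.E_splitSum (splitTerm s p l) (fun _ _ _ _ _ _ _ => rfl),
    μ.E_rootSum rootProd (fun _ _ _ _ _ _ _ => rfl), h2, h3] at h1
  have : μ.dens T₀ = μ.E (Fin 5) T₀.isoInd := rfl
  rw [this]
  have e : (μ.E (Fin 5)) T₀.isoInd = (μ.E (Fin 5)) fun x => T₀.isoInd x := rfl
  rw [e]
  linarith

end ExchangeableLaw

/-! ### Positive homomorphisms and exchangeable laws -/

namespace Tournament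

variable {V : Type*} [Fintype V]

/-- The expansion of an isomorphism invariant into indicators of isomorphism classes. -/
theorem eq_sum_isoInd {k : ℕ} (G : TournamentClass k → ℝ) (T : Tournament (Fin k)) :
    G ⟦T⟧ = ∑ F : TournamentClass k, G F * F.out.isoInd T := by
  classical
  rw [Finset.sum_eq_single (⟦T⟧ : TournamentClass k)]
  · have h : (⟦T⟧ : TournamentClass k).out.Isom T := Quotient.mk_out T
    rw [isoInd, if_pos h, mul_one]
  · intro F _ hF
    rw [isoInd, if_neg, mul_zero]
    intro h
    exact hF (by rw [← F.out_eq]; exact Quotient.sound h)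
  · simp

theorem density_eq_avg_out {k n : ℕ} (hkn : k ≤ n) (F : TournamentClass k)
    (F' : TournamentClass n) :
    F.density F' = F'.out.avg (F.out.isoInd : Tournament (Fin k) → ℝ) := by
  conv_lhs => rw [← F.out_eq, ← F'.out_eq]
  exact density_eq_avg hkn F.out F'.out

/-- A mean over random embeddings into `S` only depends on the densities in `S`. -/
theorem avg_eq_sum_density {k n : ℕ} (hk : Fintype.card V ≤ k) (hn : k ≤ n)
    (F' : TournamentClass n) (g : Tournament V → ℝ) :
    F'.out.avg g = ∑ F : TournamentClass k, F.density F' * F.out.avg g := by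
  have h1 : Nonempty (Fin k ↪ Fin n) := nonempty_embedding (by simpa using hn)
  have h2 : (fun T : Tournament (Fin k) => T.avg g) =
      fun T => ∑ F : TournamentClass k, F.out.avg g * F.out.isoInd T := by
    funext T
    rw [← avg_isom (Quotient.mk_out T : (⟦T⟧ : TournamentClass k).out.Isom T) g]
    exact eq_sum_isoInd (fun F : TournamentClass k => F.out.avg g) T
  rw [← F'.out.avg_avg h1 (nonempty_embedding hk)]
  rw [h2]
  have h3 : ∀ F : TournamentClass k, F.density F' * F.out.avg g =
      F'.out.avg fun T : Tournament (Fin k) => F.out.avg g * F.out.isoInd T := fun F => by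
    rw [density_eq_avg_out hn, mul_comm]
    exact (F'.out.avg_smul (F.out.avg g) _).symm
  simp only [h3]
  unfold avg
  rw [← Finset.sum_div, Finset.sum_comm]

end Tournament

namespace PosHom

/-- The isomorphism classes generate the flag algebra. -/
theorem ext_eval {φ ψ : PosHom} (h : ∀ (k : ℕ) (T : Tournament (Fin k)), φ.eval T = ψ.eval T) :
    φ = ψ := by
  refine Subtype.ext (Ideal.Quotient.algHom_ext _ (MvPolynomial.algHom_ext fun ⟨k, F⟩ => ?_))
  induction F using Quotient.inductionOn with
  | h T => exact h k T

/-- The value of a homomorphism on an isomorphism class. -/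
noncomputable def evalClass (φ : PosHom) {k : ℕ} (F : TournamentClass k) : ℝ :=
  φ.1 (Ideal.Quotient.mk _ (FlagAlgebra.gen F))

theorem eval_eq_evalClass (φ : PosHom) {k : ℕ} (T : Tournament (Fin k)) :
    φ.eval T = φ.evalClass ⟦T⟧ := rfl

theorem evalClass_nonneg (φ : PosHom) {k : ℕ} (F : TournamentClass k) : 0 ≤ φ.evalClass F := by
  induction F using Quotient.inductionOn with
  | h T => exact (φ.2 k T).1

theorem evalClass_unit (φ : PosHom) (F : TournamentClass 0) : φ.evalClass F = 1 := by
  have h : Ideal.Quotient.mk (Ideal.span {f | FlagAlgebra.Rel f}) (FlagAlgebra.gen F - 1) = 0 :=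
    Ideal.Quotient.eq_zero_iff_mem.2 (Ideal.subset_span (FlagAlgebra.Rel.unit F))
  rw [map_sub, map_one, sub_eq_zero] at h
  rw [evalClass, h, map_one]

theorem evalClass_chain (φ : PosHom) {k l : ℕ} (hkl : k ≤ l) (F : TournamentClass k) :
    φ.evalClass F = ∑ F' : TournamentClass l, F.density F' * φ.evalClass F' := by
  have h : Ideal.Quotient.mk (Ideal.span {f | FlagAlgebra.Rel f}) _ = 0 :=
    Ideal.Quotient.eq_zero_iff_mem.2 (Ideal.subset_span (FlagAlgebra.Rel.chain hkl F))
  rw [map_sub, sub_eq_zero] at h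
  rw [evalClass, h, map_sum, map_sum]
  refine Finset.sum_congr rfl fun F' _ => ?_
  rw [map_mul, map_mul]
  congr 1
  exact φ.1.commutes _

end PosHom

namespace ExchangeableLaw

/-- The law given by a positive homomorphism `φ`: a labelled tournament on `V` is drawn by choosing an
isomorphism class `F` with probability `φ(F)` and a random labelling of it. -/
noncomputable def ofPosHom (φ : PosHom) : ExchangeableLaw where
  E V _ :=
    { toFun := fun g => ∑ F : TournamentClass (Fintype.card V), φ.evalClass F * F.out.avg g
      map_add' := fun g g' => by simp only [avg_add, mul_add, Finset.sum_add_distrib]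
      map_smul' := fun c g => by
        simp only [avg_smul, Finset.mul_sum, RingHom.id_apply, smul_eq_mul]
        exact Finset.sum_congr rfl fun F _ => mul_left_comm _ _ _ }
  nonneg V _ g hg := Finset.sum_nonneg fun F _ =>
    mul_nonneg (φ.evalClass_nonneg F) (F.out.avg_nonneg hg)
  one V _ := by
    have h := φ.evalClass_chain (Nat.zero_le (Fintype.card V)) ⟦transitive (Fin 0)⟧
    rw [φ.evalClass_unit] at h
    refine Eq.trans ?_ h.symm
    refine Finset.sum_congr rfl fun F _ => ?_
    rw [avg_one _ (nonempty_embedding le_rfl), density_eq_avg_out (Nat.zero_le _)]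
    have : ∀ T T' : Tournament (Fin 0), T.isoInd T' = 1 := fun T T' =>
      if_pos (isom_iff_exists_equiv.2 ⟨Equiv.refl _, ext_adj fun v => v.elim0⟩)
    rw [mul_comm, show (_ : Tournament (Fin 0) → ℝ) = 1 from funext (this _),
      avg_one _ (nonempty_embedding (by simp))]
  comap V W _ _ f g := by
    have hVW : Fintype.card V ≤ Fintype.card W := Fintype.card_le_of_embedding f
    simp only [LinearMap.coe_mk, AddHom.coe_mk, avg_comap _ (nonempty_embedding le_rfl)]
    have h : ∀ F : TournamentClass (Fintype.card W), φ.evalClass F * F.out.avg g =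
        ∑ F' : TournamentClass (Fintype.card V), F'.density F * φ.evalClass F * F'.out.avg g := by
      intro F
      rw [avg_eq_sum_density le_rfl hVW, Finset.mul_sum]
      exact Finset.sum_congr rfl fun F' _ => by ring
    simp only [h]
    rw [Finset.sum_comm]
    refine Finset.sum_congr rfl fun F' _ => ?_
    rw [φ.evalClass_chain hVW F', Finset.sum_mul]

variable {μ : ExchangeableLaw}

theorem dens_ofPosHom (φ : PosHom) {k : ℕ} (T : Tournament (Fin k)) :
    (ofPosHom φ).dens T = φ.eval T := by
  have hk : k ≤ Fintype.card (Fin k) := (Fintype.card_fin k).ge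
  rw [φ.eval_eq_evalClass, φ.evalClass_chain hk]
  refine Finset.sum_congr rfl fun F _ => ?_
  rw [mul_comm]
  congr 1
  conv_rhs => rw [← F.out_eq]
  exact (density_eq_avg hk T F.out).symm

/-- The expectation of an isomorphism invariant. -/
theorem E_class (μ : ExchangeableLaw) {l : ℕ} (G : TournamentClass l → ℝ) :
    μ.E (Fin l) (fun U => G ⟦U⟧) = ∑ F, G F * μ.dens F.out := by
  have h : (fun U : Tournament (Fin l) => G ⟦U⟧) =
      fun U => ∑ F : TournamentClass l, G F * F.out.isoInd U := by
    funext T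
    exact eq_sum_isoInd G T
  rw [h, E_sum]
  exact Finset.sum_congr rfl fun F _ => μ.E_const_mul _ _

theorem dens_out (μ : ExchangeableLaw) {k : ℕ} (T : Tournament (Fin k)) :
    μ.dens (⟦T⟧ : TournamentClass k).out = μ.dens T :=
  μ.dens_congr (Quotient.mk_out T)

/-- The multiplicative relation of the flag algebra holds for the densities under a carousel law. -/
theorem dens_mul_dens (h : μ.IsCarousel) {k₁ k₂ l : ℕ} (hl : k₁ + k₂ ≤ l)
    (T₁ : Tournament (Fin k₁)) (T₂ : Tournament (Fin k₂)) :
    μ.dens T₁ * μ.dens T₂ = μ.E (Fin l) (fun U => T₁.jointDensity T₂ U) := by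
  rw [dens, dens, ← h.E_mul _ (isoInd_nonneg T₁) _ (isoInd_nonneg T₂),
    μ.E_eq_E_avg (k := l) (by simpa using hl)]
  congr 1
  funext U
  exact (jointDensity_eq_avg hl T₁ T₂ U).symm

theorem dens_zero (μ : ExchangeableLaw) (T : Tournament (Fin 0)) : μ.dens T = 1 := by
  rw [dens, ← μ.one (Fin 0)]
  congr 1
  funext U
  rw [isoInd, if_pos, Pi.one_apply]
  exact isom_iff_exists_equiv.2 ⟨Equiv.refl _, ext_adj fun v => v.elim0⟩

/-- The evaluation of polynomials in the isomorphism classes at the densities. -/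
noncomputable def densHom (μ : ExchangeableLaw) :
    MvPolynomial (Σ n, TournamentClass n) ℝ →ₐ[ℝ] ℝ :=
  MvPolynomial.aeval fun x => μ.dens x.2.out

theorem densHom_gen (μ : ExchangeableLaw) {k : ℕ} (F : TournamentClass k) :
    μ.densHom (FlagAlgebra.gen F) = μ.dens F.out :=
  MvPolynomial.aeval_X _ _

theorem densHom_sum (μ : ExchangeableLaw) {l : ℕ} (G : TournamentClass l → ℝ) :
    μ.densHom (∑ F, MvPolynomial.C (G F) * FlagAlgebra.gen F) =
      μ.E (Fin l) (fun U => G ⟦U⟧) := by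
  rw [E_class, map_sum]
  refine Finset.sum_congr rfl fun F _ => ?_
  rw [map_mul, densHom_gen]
  congr 1
  exact MvPolynomial.aeval_C _ _

theorem IsCarousel.densHom_rel (h : μ.IsCarousel) {f : MvPolynomial (Σ n, TournamentClass n) ℝ}
    (hf : FlagAlgebra.Rel f) : μ.densHom f = 0 := by
  induction hf with
  | unit F => rw [map_sub, map_one, densHom_gen, dens_zero, sub_self]
  | chain hkl F =>
    induction F using Quotient.inductionOn with
    | h T =>
      rw [map_sub, densHom_gen, densHom_sum, dens_out, dens_eq_E_density μ hkl]
      exact sub_self _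
  | mul hl F₁ F₂ =>
    induction F₁, F₂ using Quotient.inductionOn₂ with
    | h T₁ T₂ =>
      rw [map_sub, map_mul, densHom_gen, densHom_gen, densHom_sum, dens_out, dens_out,
        dens_mul_dens h hl]
      exact sub_self _

/-- The positive homomorphism given by the densities under the carousel law. -/
noncomputable def IsCarousel.toPosHom (h : μ.IsCarousel) : PosHom :=
  ⟨Ideal.Quotient.liftₐ _ μ.densHom fun f hf => by
    have : Ideal.span {f | FlagAlgebra.Rel f} ≤ RingHom.ker μ.densHom :=
      Ideal.span_le.2 fun f hf => h.densHom_rel hf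
    exact this hf, fun k T => by
    have h : μ.densHom (FlagAlgebra.gen ⟦T⟧) = μ.dens T := (μ.densHom_gen _).trans (μ.dens_out T)
    change μ.densHom (FlagAlgebra.gen ⟦T⟧) ∈ _
    rw [h]
    exact ⟨μ.dens_nonneg T, μ.dens_le_one T⟩⟩

theorem IsCarousel.eval_toPosHom (h : μ.IsCarousel) {k : ℕ} (T : Tournament (Fin k)) :
    h.toPosHom.eval T = μ.dens T :=
  (μ.densHom_gen _).trans (μ.dens_out T)

end ExchangeableLaw

/-! ### Limits of sequences of tournaments -/

namespace Tournament

variable {V W : Type*} [Fintype V] [Fintype W]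

theorem abs_avg_le (S : Tournament W) (g : Tournament V → ℝ) : |S.avg g| ≤ ∑ T, |g T| := by
  unfold avg
  rw [abs_div, Nat.abs_cast]
  refine div_le_of_le_mul₀ (Nat.cast_nonneg _) (Finset.sum_nonneg fun _ _ => abs_nonneg _) ?_
  refine (Finset.abs_sum_le_sum_abs _ _).trans ?_
  refine (Finset.sum_le_card_nsmul _ _ (∑ T, |g T|) fun h _ => ?_).trans ?_
  · exact Finset.single_le_sum (f := fun T => |g T|) (fun _ _ => abs_nonneg _) (Finset.mem_univ _)
  · rw [nsmul_eq_mul, Finset.card_univ, mul_comm]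

end Tournament

namespace ExchangeableLaw

section

variable {s : ℕ → ℕ} (S : ∀ i, Tournament (Fin (s i))) (U : Ultrafilter ℕ)

theorem tendsto_avg {V : Type} [Fintype V] (g : Tournament V → ℝ) :
    Tendsto (fun i => (S i).avg g) U (𝓝 (limUnder (U : Filter ℕ) fun i => (S i).avg g)) := by
  obtain ⟨a, -, ha⟩ := (isCompact_Icc (a := -∑ T, |g T|) (b := ∑ T, |g T|)).ultrafilter_le_nhds
    (U.map fun i => (S i).avg g) (by
      rw [Ultrafilter.coe_map, le_principal_iff, mem_map]
      exact univ_mem' fun i => abs_le.1 ((S i).abs_avg_le g))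
  exact tendsto_nhds_limUnder ⟨a, ha⟩

/-- The limit of the laws of random induced subtournaments of `S i` along an ultrafilter. -/
noncomputable def ofSeq (hs : Tendsto s U atTop) : ExchangeableLaw where
  E V _ :=
    { toFun := fun g => limUnder (U : Filter ℕ) fun i => (S i).avg g
      map_add' := fun g g' => by
        refine tendsto_nhds_unique (tendsto_avg S U _) ?_
        simp only [avg_add]
        exact (tendsto_avg S U g).add (tendsto_avg S U g')
      map_smul' := fun c g => by
        refine tendsto_nhds_unique (tendsto_avg S U _) ?_
        simp only [avg_smul]
        exact (tendsto_avg S U g).const_mul c }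
  nonneg V _ g hg := ge_of_tendsto' (tendsto_avg S U g) fun i => (S i).avg_nonneg hg
  one V _ := by
    refine tendsto_nhds_unique (tendsto_avg S U _) (tendsto_const_nhds.congr' ?_)
    filter_upwards [hs.eventually_ge_atTop (Fintype.card V)] with i hi
    exact ((S i).avg_one (nonempty_embedding hi)).symm
  comap V W _ _ f g := by
    refine tendsto_nhds_unique (tendsto_avg S U _) ((tendsto_avg S U g).congr' ?_)
    filter_upwards [hs.eventually_ge_atTop (Fintype.card W)] with i hi
    exact ((S i).avg_comap (nonempty_embedding hi) f g).symm

theorem tendsto_E_ofSeq (hs : Tendsto s U atTop) {V : Type} [Fintype V] (g : Tournament V → ℝ) :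
    Tendsto (fun i => (S i).avg g) U (𝓝 ((ofSeq S U hs).E V g)) :=
  tendsto_avg S U g

theorem tendsto_dens_ofSeq (hs : Tendsto s U atTop) {k : ℕ} (T : Tournament (Fin k)) :
    Tendsto (fun i => T.density (S i)) U (𝓝 ((ofSeq S U hs).dens T)) := by
  refine (tendsto_E_ofSeq S U hs T.isoInd).congr' ?_
  filter_upwards [hs.eventually_ge_atTop k] with i hi
  exact (density_eq_avg hi T (S i)).symm

end

end ExchangeableLaw

/-! ### Carousels -/

namespace Tournament

variable {n : ℕ}

theorem carousel_adj_iff_eq_add {v w : Fin (2 * n + 1)} :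
    (carousel n).Adj v w ↔ ∃ i : ℕ, 1 ≤ i ∧ i ≤ n ∧ w = v + Fin.ofNat (2 * n + 1) i := by
  refine exists_congr fun i => and_congr_right fun _ => and_congr_right fun _ => ?_
  rw [Fin.ext_iff, Fin.val_add, Fin.val_ofNat, Nat.add_mod_mod]

theorem carousel_adj_iff_lt {v w : Fin (2 * n + 1)} :
    (carousel n).Adj v w ↔ ((v : ℕ) < w ∧ (w : ℕ) ≤ v + n) ∨ (w : ℕ) + n < v := by
  have ha := v.2
  have hb := w.2
  constructor
  · rintro ⟨i, h1, h2, h⟩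
    rcases lt_or_ge ((v : ℕ) + i) (2 * n + 1) with hlt | hge
    · rw [Nat.mod_eq_of_lt hlt] at h
      omega
    · rw [Nat.mod_eq_sub_mod hge, Nat.mod_eq_of_lt (by omega)] at h
      omega
  · rintro (h | h)
    · exact ⟨w - v, by omega, by omega, by rw [Nat.mod_eq_of_lt (by omega)]; omega⟩
    · exact ⟨w + (2 * n + 1) - v, by omega, by omega, by
        rw [Nat.mod_eq_sub_mod (by omega), Nat.mod_eq_of_lt (by omega)]; omega⟩

/-- A carousel is locally transitive. -/
theorem carousel_not_dominated {a b c d : Fin (2 * n + 1)} (hab : (carousel n).Adj a b)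
    (hbc : (carousel n).Adj b c) (hca : (carousel n).Adj c a) :
    ¬ ((carousel n).Adj d a ∧ (carousel n).Adj d b ∧ (carousel n).Adj d c) ∧
    ¬ ((carousel n).Adj a d ∧ (carousel n).Adj b d ∧ (carousel n).Adj c d) := by
  simp only [carousel_adj_iff_lt] at *
  have := a.2
  have := b.2
  have := c.2
  have := d.2
  constructor <;> omega

theorem carousel_allGood (n : ℕ) : (carousel n).AllGood := by
  intro w x y z
  by_contra hg
  have hne : ¬ (w = x ∨ w = y ∨ w = z ∨ x = y ∨ x = z ∨ y = z) := fun h =>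
    hg ((carousel n).good_of_not_distinct h)
  push Not at hne
  obtain ⟨h1, h2, h3, h4, h5, h6⟩ := hne
  have hno : ∀ a b c d, (cyc (carousel n).mat a b c &&
      (dom (carousel n).mat d a b c || codom (carousel n).mat d a b c)) = false := by
    intro a b c d
    rw [Bool.eq_false_iff]
    simp only [cyc, dom, codom, ne_eq, Bool.and_eq_true, Bool.or_eq_true, mat_eq_true]
    rintro ⟨⟨⟨hab, hbc⟩, hca⟩ | ⟨⟨hba, hcb⟩, hac⟩, h⟩
    · have := carousel_not_dominated (d := d) hab hbc hca
      tauto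
    · have := carousel_not_dominated (d := d) hac hcb hba
      tauto
  have := exists_triangle_of_not_good _ w x y z ((carousel n).mat_symm h1)
    ((carousel n).mat_symm h2) ((carousel n).mat_symm h3) ((carousel n).mat_symm h4)
    ((carousel n).mat_symm h5) ((carousel n).mat_symm h6) (by simpa using hg)
  simp [hno] at this

/-- The reflection at `x` exchanges the vertices that `x` beats and those that beat `x`. -/
theorem sgn_carousel_reflect (x y : Fin (2 * n + 1)) :
    sgn (carousel n).mat x (x + x - y) = -sgn (carousel n).mat x y := by
  have h1 : (carousel n).mat x (x + x - y) = (carousel n).mat y x := by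
    rw [Bool.eq_iff_iff, mat_eq_true, mat_eq_true, carousel_adj_iff_eq_add, carousel_adj_iff_eq_add]
    refine exists_congr fun i => and_congr_right fun _ => and_congr_right fun _ => ?_
    rw [sub_eq_iff_eq_add, add_assoc, add_right_inj, add_comm _ y]
  have h2 : (carousel n).mat (x + x - y) x = (carousel n).mat x y := by
    rw [Bool.eq_iff_iff, mat_eq_true, mat_eq_true, carousel_adj_iff_eq_add, carousel_adj_iff_eq_add]
    refine exists_congr fun i => and_congr_right fun _ => and_congr_right fun _ => ?_
    rw [sub_add_eq_add_sub, eq_sub_iff_add_eq, add_assoc, add_right_inj]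
  rw [sgn_symm (carousel n) y x, neg_neg]
  unfold sgn
  rw [h1, h2]

/-- Distinct neighbours of a random vertex of a carousel are not positively correlated: the sum over
all triples of vertices vanishes by reflection, and the triples with repetitions contribute
nonnegative terms. -/
theorem avg_carousel_balance_nonpos (n : ℕ) :
    (carousel n).avg (fun T : Tournament (Fin 3) =>
      ((sgn T.mat 0 1 * sgn T.mat 0 2 : ℤ) : ℝ)) ≤ 0 := by
  classical
  set F : (Fin 3 → Fin (2 * n + 1)) → ℝ := fun f =>
    ((sgn (carousel n).mat (f 0) (f 1) * sgn (carousel n).mat (f 0) (f 2) : ℤ) : ℝ) with hF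
  have hinv : Function.Involutive fun f : Fin 3 → Fin (2 * n + 1) =>
      Function.update f 2 (f 0 + f 0 - f 2) := by
    intro f
    funext i
    fin_cases i <;> simp
  have hzero : ∑ f, F f = 0 := by
    have h := Equiv.sum_comp (Function.Involutive.toPerm _ hinv) F
    have h' : ∀ f, F ((Function.Involutive.toPerm _ hinv) f) = -F f := by
      intro f
      simp [hF, sgn_carousel_reflect]
    simp only [h', Finset.sum_neg_distrib] at h
    linarith
  have hle : ∑ h : Fin 3 ↪ Fin (2 * n + 1), F h ≤ ∑ f, F f := by
    have e := Finset.sum_map Finset.univ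
      (⟨fun h : Fin 3 ↪ Fin (2 * n + 1) => ⇑h, DFunLike.coe_injective⟩ :
        (Fin 3 ↪ Fin (2 * n + 1)) ↪ (Fin 3 → Fin (2 * n + 1))) F
    rw [Function.Embedding.coeFn_mk] at e
    rw [← e]
    refine Finset.sum_le_sum_of_subset_of_nonneg (Finset.subset_univ _) fun f _ hf => ?_
    have hinj : ¬ Function.Injective f := fun hi => hf (by
      simp only [Finset.mem_map, Finset.mem_univ, true_and]
      exact ⟨⟨f, hi⟩, rfl⟩)
    have : f 0 = f 1 ∨ f 0 = f 2 ∨ f 1 = f 2 := by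
      by_contra hc
      push Not at hc
      obtain ⟨h1, h2, h3⟩ := hc
      apply hinj
      intro a b hab
      fin_cases a <;> fin_cases b <;> simp_all
    rcases this with h | h | h
    · simp [hF, ← h, sgn_self]
    · simp [hF, ← h, sgn_self]
    · simp only [hF, h]
      exact_mod_cast mul_self_nonneg _
  refine div_nonpos_of_nonpos_of_nonneg ?_ (Nat.cast_nonneg _)
  rw [hzero] at hle
  exact hle

end Tournament

namespace ExchangeableLaw

/-- The limits of the carousels are carousel laws. -/
theorem isCarousel_ofSeq_carousel (U : Ultrafilter ℕ)
    (hs : Tendsto (fun n => 2 * n + 1) U atTop) :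
    (ofSeq (fun n => carousel n) U hs).IsCarousel := by
  constructor
  · exact le_antisymm (le_of_tendsto' (tendsto_E_ofSeq _ U hs _) avg_carousel_balance_nonpos)
      (E_balance_nonneg _)
  · refine tendsto_nhds_unique (tendsto_E_ofSeq _ U hs _) ?_
    refine tendsto_const_nhds.congr fun n => ?_
    rw [(carousel n).avg_congr (g' := fun _ => 0) fun f => by
      simp [(carousel_allGood n).comap f 0 1 2 3]]
    simp [avg]

end ExchangeableLaw

/-! ### Extremal sequences and extremal homomorphisms -/

theorem ExchangeableLaw.dens_le_maxDensity (μ : ExchangeableLaw) {k n : ℕ} (h : k ≤ n)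
    (T : Tournament (Fin k)) : μ.dens T ≤ T.maxDensity n := by
  rw [μ.dens_eq_E_density h, ← μ.E_const (V := Fin n) (T.maxDensity n)]
  exact μ.mono fun U => Finset.le_sup' (fun U => T.density U) (Finset.mem_univ U)

namespace Tournament

open ExchangeableLaw

variable {μ : ExchangeableLaw} {T₀ : Tournament (Fin 5)} {N M r s p l : ℤ}

/-- The maximal density tends to the density under a carousel law: it is at least that density by
averaging, and a limit of maximizers is a law, to which the upper bound applies. -/
theorem HasLocalBound.tendsto_maxDensity (h : T₀.HasLocalBound N M r s p l) (hM : 0 < M)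
    (hμ : μ.IsCarousel) : Tendsto T₀.maxDensity atTop (𝓝 (μ.dens T₀)) := by
  have hM' : (0 : ℝ) < M := by exact_mod_cast hM
  rw [tendsto_iff_ultrafilter]
  intro U hU
  have hS : ∀ n, ∃ S : Tournament (Fin n), T₀.maxDensity n = T₀.density S := fun n => by
    obtain ⟨S, -, hS⟩ := Finset.exists_mem_eq_sup' (Finset.univ_nonempty (α := Tournament (Fin n)))
      fun S => T₀.density S
    exact ⟨S, hS⟩
  choose S hS using hS
  have ht := tendsto_dens_ofSeq S U (tendsto_id.mono_left hU) T₀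
  simp only [← hS] at ht
  have hle : (ofSeq S U (tendsto_id.mono_left hU)).dens T₀ ≤ μ.dens T₀ := by
    refine le_of_mul_le_mul_left ?_ hM'
    rw [hμ.mul_dens_eq h]
    exact mul_dens_le h
  have hge : μ.dens T₀ ≤ (ofSeq S U (tendsto_id.mono_left hU)).dens T₀ :=
    ge_of_tendsto ht (hU (eventually_ge_atTop 5 |>.mono fun n hn => μ.dens_le_maxDensity hn T₀))
  rwa [le_antisymm hle hge] at ht

/-- If every ultrafilter limit of `S` is the carousel law, then `S` converges to it. -/
theorem convergesTo_of_isCarousel {t : ℕ → ℕ} (ht : StrictMono t) (S : ∀ i, Tournament (Fin (t i)))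
    (hμ : μ.IsCarousel)
    (hS : ∀ U : Ultrafilter ℕ, ∀ hU : (U : Filter ℕ) ≤ atTop,
      (ofSeq S U (ht.tendsto_atTop.mono_left hU)).IsCarousel) :
    ConvergesTo S hμ.toPosHom := by
  refine ⟨ht, fun k T => ?_⟩
  rw [tendsto_iff_ultrafilter]
  intro U hU
  have := tendsto_dens_ofSeq S U (ht.tendsto_atTop.mono_left hU) T
  rw [dens, (hS U hU).E_unique hμ] at this
  rwa [hμ.eval_toPosHom]

theorem HasLocalBound.isExtremal_iff (h : T₀.HasLocalBound N M r s p l) (hM : 0 < M)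
    (hμ : μ.IsCarousel) {t : ℕ → ℕ} (ht : StrictMono t) (S : ∀ i, Tournament (Fin (t i))) :
    T₀.IsExtremal S ↔ ConvergesTo S hμ.toPosHom := by
  have hmax := h.tendsto_maxDensity hM hμ
  constructor
  · rintro ⟨c, hc, hS⟩
    rw [tendsto_nhds_unique hc hmax] at hS
    refine convergesTo_of_isCarousel ht S hμ fun U hU => isCarousel_of_mul_dens_eq h ?_
    rw [tendsto_nhds_unique (tendsto_dens_ofSeq S U (ht.tendsto_atTop.mono_left hU) T₀)
      (hS.mono_left hU)]
    exact hμ.mul_dens_eq h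
  · intro hS
    refine ⟨_, hmax, ?_⟩
    rw [← hμ.eval_toPosHom]
    exact hS.2 5 T₀

theorem HasLocalBound.eval_le (h : T₀.HasLocalBound N M r s p l) (hM : 0 < M)
    (hμ : μ.IsCarousel) (φ : PosHom) : φ.eval T₀ ≤ μ.dens T₀ := by
  have hM' : (0 : ℝ) < M := by exact_mod_cast hM
  refine le_of_mul_le_mul_left ?_ hM'
  rw [hμ.mul_dens_eq h, ← dens_ofPosHom]
  exact mul_dens_le h

theorem HasLocalBound.eval_eq_iff (h : T₀.HasLocalBound N M r s p l)
    (hμ : μ.IsCarousel) (φ : PosHom) : φ.eval T₀ = μ.dens T₀ ↔ φ = hμ.toPosHom := by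
  constructor
  · intro he
    have hφ : (ofPosHom φ).IsCarousel := isCarousel_of_mul_dens_eq h (by
      rw [dens_ofPosHom, he]
      exact hμ.mul_dens_eq h)
    refine PosHom.ext_eval fun k T => ?_
    rw [hμ.eval_toPosHom, ← dens_ofPosHom]
    exact hφ.E_unique hμ _
  · rintro rfl
    exact hμ.eval_toPosHom T₀

end Tournament

theorem theorem2 :
    Tendsto (Tournament.maxDensity Tournament.T57) atTop (𝓝 (5 / 16 : ℝ)) ∧
    Tendsto (Tournament.maxDensity Tournament.T512) atTop (𝓝 (1 / 16 : ℝ)) ∧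
    ∃ φR : PosHom,
      Tournament.ConvergesTo (s := fun n => 2 * n + 1) (fun n => Tournament.carousel n) φR ∧
      (∀ (s : ℕ → ℕ) (_ : StrictMono s) (S : ∀ i, Tournament (Fin (s i))),
        (Tournament.IsExtremal Tournament.T57 S ↔ Tournament.ConvergesTo S φR) ∧
        (Tournament.IsExtremal Tournament.T512 S ↔ Tournament.ConvergesTo S φR)) ∧
      (∀ φ : PosHom,
        (φ.eval Tournament.T57 ≤ 5 / 16 ∧ (φ.eval Tournament.T57 = 5 / 16 ↔ φ = φR)) ∧
        (φ.eval Tournament.T512 ≤ 1 / 16 ∧ (φ.eval Tournament.T512 = 1 / 16 ↔ φ = φR))) := by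
  have hs : StrictMono fun n : ℕ => 2 * n + 1 := fun a b hab => by dsimp only; omega
  obtain ⟨μ, hμ⟩ : ∃ μ : ExchangeableLaw, μ.IsCarousel :=
    ⟨_, ExchangeableLaw.isCarousel_ofSeq_carousel (Ultrafilter.of atTop)
      (hs.tendsto_atTop.mono_left (Ultrafilter.of_le _))⟩
  have h57 : μ.dens T57 = 5 / 16 := by
    have := hμ.mul_dens_eq hasLocalBound_T57
    push_cast at this
    linarith
  have h512 : μ.dens T512 = 1 / 16 := by
    have := hμ.mul_dens_eq hasLocalBound_T512
    push_cast at this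
    linarith
  rw [← h57, ← h512]
  exact ⟨hasLocalBound_T57.tendsto_maxDensity (by norm_num) hμ,
    hasLocalBound_T512.tendsto_maxDensity (by norm_num) hμ, hμ.toPosHom,
    convergesTo_of_isCarousel hs _ hμ fun U _ => ExchangeableLaw.isCarousel_ofSeq_carousel U _,
    fun t ht S => ⟨hasLocalBound_T57.isExtremal_iff (by norm_num) hμ ht S,
      hasLocalBound_T512.isExtremal_iff (by norm_num) hμ ht S⟩,
    fun φ => ⟨⟨hasLocalBound_T57.eval_le (by norm_num) hμ φ, hasLocalBound_T57.eval_eq_iff hμ φ⟩,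
      ⟨hasLocalBound_T512.eval_le (by norm_num) hμ φ, hasLocalBound_T512.eval_eq_iff hμ φ⟩⟩⟩
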